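/- Consider the four cases $(2,2,2,2)$, $(3,3,3)$, $(2,4,4)$, $(2,3,6)$. In these cases let $W\subset\mathbb C^*$ be the group of $n$-th roots of unity with $n=|W|=2,3,4,6$ respectively, and for a lattice $\Lambda\subset\mathbb C$ let $S_\Lambda$ be $\wp_\Lambda,\ \wp_\Lambda',\ \wp_\Lambda'',\ \wp_\Lambda^{(4)}$ respectively, where $\wp_\Lambda$ is the Weierstrass function of $\Lambda$. For a function $g$ meromorphic at $0$, let $g[0]$ be the constant term of its Laurent expansion at $0$. (a) Let $\Lambda\subset\Lambda'$ be lattices in $\mathbb C$, both invariant under multiplication by $W$, with $[\Lambda':\Lambda]=p<\infty$. For $u\in\Lambda'$ let $|W_u|$ be the number of $\xi\in W$ with $\xi u-u\in\Lambda$. Then there is a rational function $R\in\mathbb C(w)$ such that for all $z\notin\Lambda'$ $$S_{\Lambda'}(z)=R(S_\Lambda(z)),$$ and $R$ is given, for every choice of representatives $u\in\Lambda'$ of the orbits of $W$ on the nonzero elements of $\Lambda'/\Lambda$, by $$R(w)=(-1)^{|W|+1}\sum_{0\ne u\in(\Lambda'/\Lambda)/W}\frac1{|W_u|}\,\frac{\partial^{|W|}}{\partial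 u^{|W|}}\log\bigl(S_\Lambda(u)-w\bigr)+w+S_{\Lambda'}[0]-S_\Lambda[0]$$ for every $w$ different from all the numbers $S_\Lambda(u)$. $R$ has no pole at such $w$, and $S_\Lambda(z)$ is such a $w$ for every $z\notin\Lambda'$. If $p$ is coprime to $|W|$, then $$R(w)=(-1)^{|W|+1}\sum_{0\ne u\in(\Lambda'/\Lambda)/W}\frac{\partial^{|W|}}{\partial u^{|W|}}\log\bigl(S_\Lambda(u)-w\bigr)+w+S_{\Lambda'}[0]-S_\Lambda[0].$$ (b) In case $(2,2,2,2)$, let $p$ be an odd positive integer, $\tau\in\mathbb C\setminus\mathbb R$, let $\Lambda'$ be generated by $1,\tau$ and $\Lambda$ by $p,\tau$, and write $\wp=\wp_\Lambda$. Then $\wp_{\Lambda'}(z)=R(\wp(z))$ for all $z\notin\Lambda'$, where $$R(w)=\sum_{u=1}^{(p-1)/2}\left(\left(\frac{\wp'(u)}{\wp(u)-w}\right)^2-\frac{\wp''(u)}{\wp(u)-w}\right)+w,$$ and $\wp(u)\ne\wp(z)$ for all $z\notin\Lambda'$ and $1\le u\le (p-1)/2$. -/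

import Mathlib

open Filter Topology

/-- The four types of branching data for Galois branched coverings of the Riemann sphere
by a complex torus. -/
inductive TorusCase
  | case2222
  | case333
  | case244
  | case236

namespace TorusCase

/-- The order `|W|` of the group `W` of roots of unity attached to each case. -/
def order : TorusCase → ℕ
  | case2222 => 2
  | case333 => 3
  | case244 => 4
  | case236 => 6

/-- The function `S_Λ`: `℘`, `℘'`, `℘''`, `℘⁗` respectively, for the lattice `Λ` spanned by a
pair of periods. -/
noncomputable def S (c : TorusCase) (L : PeriodPair) : ℂ → ℂ :=
  match c with
  | case2222 => L.weierstrassP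
  | case333 => iteratedDeriv 1 L.weierstrassP
  | case244 => iteratedDeriv 2 L.weierstrassP
  | case236 => iteratedDeriv 4 L.weierstrassP

end TorusCase

/-- `Λ` is invariant under multiplication by the `n`-th roots of unity. -/
def IsRootInvariant (n : ℕ) (Λ : Submodule ℤ ℂ) : Prop :=
  ∀ ξ : ℂ, ξ ^ n = 1 → ∀ v ∈ Λ, ξ * v ∈ Λ

/-- `U` contains exactly one representative of each orbit of the group of `n`-th roots of unity
on the nonzero elements of `Λ' / Λ`, and nothing else. -/
def IsOrbitTransversal (n : ℕ) (Λ Λ' : Submodule ℤ ℂ) (U : Finset ℂ) : Prop :=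
  (∀ u ∈ U, u ∈ Λ' ∧ u ∉ Λ) ∧
    ∀ v ∈ Λ', v ∉ Λ → ∃! u : ℂ, u ∈ U ∧ ∃ ξ : ℂ, ξ ^ n = 1 ∧ v - ξ * u ∈ Λ

/-- The number of `n`-th roots of unity `ξ` that fix the class of `u` modulo `Λ`. -/
noncomputable def stabilizerCard (n : ℕ) (Λ : Submodule ℤ ℂ) (u : ℂ) : ℕ :=
  Set.ncard {ξ : ℂ | ξ ^ n = 1 ∧ ξ * u - u ∈ Λ}

/-- The constant term `g[0]` of the Laurent expansion at `0` of a function `g` with an isolated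
singularity at `0`: the value of `(2πi)⁻¹ ∮_{|z| = r} g(z) / z dz` for small `r > 0`. -/
noncomputable def laurentConst (g : ℂ → ℂ) : ℂ :=
  limUnder (𝓝[>] (0 : ℝ)) fun r : ℝ =>
    (2 * (Real.pi : ℂ) * Complex.I)⁻¹ * ∮ z in C(0, r), g z / z

/-- The `n`-th derivative (`n ≥ 1`) of `log f` at `u`, which does not depend on the branch of
the logarithm: the `(n - 1)`-st derivative of the logarithmic derivative `f' / f`. -/
noncomputable def iteratedDerivLog (n : ℕ) (f : ℂ → ℂ) (u : ℂ) : ℂ :=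
  iteratedDeriv (n - 1) (logDeriv f) u

/-- `iteratedDerivLog` is the `n`-th derivative of every local branch `ℓ` of `log f`. -/
theorem iteratedDeriv_eq_iteratedDerivLog {n : ℕ} (hn : 1 ≤ n) {f ℓ : ℂ → ℂ} {u : ℂ}
    (hd : ∀ᶠ v in 𝓝 u, DifferentiableAt ℂ ℓ v)
    (he : ∀ᶠ v in 𝓝 u, Complex.exp (ℓ v) = f v) :
    iteratedDeriv n ℓ u = iteratedDerivLog n f u := by
  obtain ⟨m, rfl⟩ : ∃ m, n = m + 1 := ⟨n - 1, by omega⟩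
  rw [iteratedDerivLog, iteratedDeriv_succ', Nat.add_sub_cancel]
  apply Filter.EventuallyEq.iteratedDeriv_eq
  filter_upwards [hd, he.eventually_nhds] with v hv hev
  have h1 : deriv f v = Complex.exp (ℓ v) * deriv ℓ v := by
    rw [← Filter.EventuallyEq.deriv_eq (f₁ := fun x => Complex.exp (ℓ x)) hev]
    exact hv.hasDerivAt.cexp.deriv
  rw [logDeriv_apply, h1, ← hev.self_of_nhds]
  field_simp [Complex.exp_ne_zero]

/-- Orbit representatives exist when the index is finite. -/
theorem exists_isOrbitTransversal {n : ℕ} (hn : n ≠ 0) {Λ Λ' : Submodule ℤ ℂ}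
    (hinv : IsRootInvariant n Λ)
    (hidx : Λ.toAddSubgroup.relIndex Λ'.toAddSubgroup ≠ 0) :
    ∃ U : Finset ℂ, IsOrbitTransversal n Λ Λ' U := by
  classical
  let T := {v : ℂ // v ∈ Λ' ∧ v ∉ Λ}
  have inv_root : ∀ ξ : ℂ, ξ ^ n = 1 → ξ⁻¹ ^ n = 1 ∧ ξ ≠ 0 := fun ξ h =>
    ⟨by rw [inv_pow, h, inv_one], by rintro rfl; simp [hn] at h⟩
  have hsymm : ∀ v u : ℂ, (∃ ξ : ℂ, ξ ^ n = 1 ∧ v - ξ * u ∈ Λ) →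
      ∃ ξ : ℂ, ξ ^ n = 1 ∧ u - ξ * v ∈ Λ := by
    rintro v u ⟨ξ, h, hm⟩
    obtain ⟨h1, h0⟩ := inv_root ξ h
    refine ⟨ξ⁻¹, h1, ?_⟩
    have := Λ.neg_mem (hinv _ h1 _ hm)
    convert this using 1
    field_simp
    ring
  let s : Setoid T :=
    { r := fun v u => ∃ ξ : ℂ, ξ ^ n = 1 ∧ v.1 - ξ * u.1 ∈ Λ
      iseqv :=
        ⟨fun v => ⟨1, one_pow n, by simp⟩, fun {v u} h => hsymm v.1 u.1 h, by
          rintro a b c ⟨ξ, h, hm⟩ ⟨η, h', hm'⟩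
          refine ⟨ξ * η, by rw [mul_pow, h, h', one_mul], ?_⟩
          have := Λ.add_mem hm (hinv _ h _ hm')
          convert this using 1
          ring⟩ }
  let Q := Λ'.toAddSubgroup ⧸ (Λ.toAddSubgroup.addSubgroupOf Λ'.toAddSubgroup)
  have hfi : (Λ.toAddSubgroup.addSubgroupOf Λ'.toAddSubgroup).FiniteIndex := ⟨hidx⟩
  have hQ : Finite Q := AddSubgroup.finite_quotient_of_finiteIndex
  let f : T → Q := fun v => QuotientAddGroup.mk ⟨v.1, v.2.1⟩
  have hf : ∀ v u : T, f v = f u → s v u := by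
    intro v u h
    have := QuotientAddGroup.eq.mp h
    rw [AddSubgroup.mem_addSubgroupOf] at this
    refine ⟨1, one_pow n, ?_⟩
    have h2 := Λ.neg_mem (show -v.1 + u.1 ∈ Λ from this)
    convert h2 using 1
    ring
  have hfin : Finite (Quotient s) :=
    Finite.of_injective (fun q : Quotient s => f q.out) fun a b h => by
      rw [← Quotient.out_eq a, ← Quotient.out_eq b]
      exact Quotient.sound (hf _ _ h)
  have := Fintype.ofFinite (Quotient s)
  refine ⟨Finset.univ.image fun q : Quotient s => q.out.1, ?_, ?_⟩
  · intro u hu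
    obtain ⟨q, -, rfl⟩ := Finset.mem_image.mp hu
    exact q.out.2
  · intro v hv hv'
    refine ⟨(Quotient.mk s ⟨v, hv, hv'⟩).out.1,
      ⟨Finset.mem_image_of_mem _ (Finset.mem_univ _), ?_⟩, ?_⟩
    · exact hsymm _ _ (Quotient.mk_out (s := s) ⟨v, hv, hv'⟩)
    · rintro u ⟨hu, h⟩
      obtain ⟨q, -, rfl⟩ := Finset.mem_image.mp hu
      have : Quotient.mk s ⟨v, hv, hv'⟩ = q := by
        rw [← Quotient.out_eq q]
        exact Quotient.sound h
      rw [this]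

/-!
Write `n = k + 2` for the order of the group `W` of roots of unity. In each of the four cases `S_Λ`
is the `k`-th derivative of `℘_Λ` (`PeriodPair.sFun`). It is `Λ`-periodic and `W`-invariant, and its
Laurent expansion at a lattice point has the single polar term `c / z ^ n` with
`c = (-1) ^ k (k + 1)!`. The proof compares elliptic functions through their polar terms
(`HasLaurent`): by Liouville's theorem an elliptic function without polar terms which vanishes at
`0` is zero (`eq_zero_of_periodic_of_hasLaurent`).

Two such comparisons are made. Firstly, `S_Λ'` has the same polar terms as the sum of the translates
of `S_Λ` by `Λ' / Λ`. Grouping the translates into `W`-orbits gives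
`S_Λ' z = S_Λ z + ∑ u, |W_u|⁻¹ Q_u z + S_Λ'[0] - S_Λ[0]`, where
`Q_u z = ∑ ξ ∈ W, (S_Λ (z - ξ u) - S_Λ (-ξ u))` (`PeriodPair.orbitSum`,
`PeriodPair.sFun_eq_sum_orbitSum`).

Secondly, `Q_u z = (-1) ^ (n + 1) ∂ⁿ/∂uⁿ log (S_Λ u - S_Λ z)`. As functions of `u` both sides are
elliptic. Their polar terms agree once it is known that `S_Λ u - S_Λ z` vanishes exactly on
`W z + Λ`, with simple zeros. For `z` near `0` this is elementary: near `0` one has `S_Λ = c ψ ^ (-n)`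
with a local coordinate `ψ` commuting with `W`, and away from the lattice `S_Λ` is bounded
(`PeriodPair.eventually_fibre`). This proves the identity for `z` near `0`
(`PeriodPair.eventually_iteratedDerivLog_eq_orbitSum`). For fixed `u` the derivative of the
logarithm is a rational function `φ` of `S_Λ z`, so both sides are meromorphic in `z` and the identity
propagates to all `z`. It then determines the fibres of `S_Λ`, without counting zeros: if
`S_Λ z₀ = S_Λ u` with `z₀` outside the orbit of `u`, then `φ (S_Λ z) = Q_u z` has a finite limit as
`z → z₀` and tends to infinity as `z → u`, which is impossible as `φ` is meromorphic at `S_Λ u`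
(`PeriodPair.sFun_ne_and_iteratedDerivLog_eq`).

The resulting formula is a rational function of `w = S_Λ z`. It does not depend on the choice of
representatives, because rational functions agreeing on the infinite set of values of `S_Λ` are
equal. The second part is the case `n = 2`, with representatives `1, …, (p - 1) / 2`.
-/

/-! ### Laurent expansions with a single polar term, and Liouville's theorem -/

/-- `f` is `c / (z - a) ^ n + b + o(1)` at `a`, up to a function analytic at `a`: the only polar
term of the Laurent expansion of `f` at `a` is `c / (z - a) ^ n`, and its constant term is `b`
(when `n ≥ 1`). The value of `f` at `a` itself plays no role. -/
def HasLaurent (f : ℂ → ℂ) (n : ℕ) (c b a : ℂ) : Prop :=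
  ∃ h : ℂ → ℂ, AnalyticAt ℂ h a ∧ h a = b ∧ ∀ᶠ z in 𝓝[≠] a, f z = c / (z - a) ^ n + h z

namespace HasLaurent

variable {f g : ℂ → ℂ} {n : ℕ} {c d b e a : ℂ}

theorem of_analyticAt (hf : AnalyticAt ℂ f a) (n : ℕ) : HasLaurent f n 0 (f a) a :=
  ⟨f, hf, rfl, by simp⟩

theorem add (hf : HasLaurent f n c b a) (hg : HasLaurent g n d e a) :
    HasLaurent (fun z => f z + g z) n (c + d) (b + e) a := by
  obtain ⟨h, h1, h2, h3⟩ := hf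
  obtain ⟨k, k1, k2, k3⟩ := hg
  refine ⟨fun z => h z + k z, h1.add k1, by rw [← h2, ← k2], ?_⟩
  filter_upwards [h3, k3] with z hz kz
  rw [hz, kz]
  ring

theorem const_mul (r : ℂ) (hf : HasLaurent f n c b a) :
    HasLaurent (fun z => r * f z) n (r * c) (r * b) a := by
  obtain ⟨h, h1, h2, h3⟩ := hf
  refine ⟨fun z => r * h z, analyticAt_const.mul h1, by rw [← h2], ?_⟩
  filter_upwards [h3] with z hz
  rw [hz]
  ring

theorem sub (hf : HasLaurent f n c b a) (hg : HasLaurent g n d e a) :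
    HasLaurent (fun z => f z - g z) n (c - d) (b - e) a := by
  have := hf.add (hg.const_mul (-1))
  simpa only [neg_mul, one_mul, ← sub_eq_add_neg] using this

theorem sub_const (hf : HasLaurent f n c b a) (r : ℂ) :
    HasLaurent (fun z => f z - r) n c (b - r) a := by
  have := hf.sub (of_analyticAt (f := fun _ => r) (a := a) analyticAt_const n)
  simpa only [sub_zero] using this

theorem sum {ι : Type*} {s : Finset ι} {F : ι → ℂ → ℂ} {C B : ι → ℂ}
    (h : ∀ i ∈ s, HasLaurent (F i) n (C i) (B i) a) :
    HasLaurent (fun z => ∑ i ∈ s, F i z) n (∑ i ∈ s, C i) (∑ i ∈ s, B i) a := by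
  classical
  induction s using Finset.induction_on with
  | empty =>
    simpa using of_analyticAt (f := fun _ => (0 : ℂ)) (a := a) analyticAt_const n
  | insert i s hi ih =>
    simp only [Finset.sum_insert hi]
    exact (h i (Finset.mem_insert_self _ _)).add
      (ih fun j hj => h j (Finset.mem_insert_of_mem hj))

theorem comp_sub {v : ℂ} (hf : HasLaurent f n c b (a - v)) :
    HasLaurent (fun z => f (z - v)) n c b a := by
  obtain ⟨h, h1, h2, h3⟩ := hf
  refine ⟨fun z => h (z - v), h1.comp_of_eq (by fun_prop) rfl, h2, ?_⟩
  have : Tendsto (fun z : ℂ => z - v) (𝓝[≠] a) (𝓝[≠] (a - v)) := by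
    refine tendsto_nhdsWithin_iff.mpr ⟨Tendsto.mono_left (Continuous.tendsto (by fun_prop) a)
      nhdsWithin_le_nhds, ?_⟩
    filter_upwards [self_mem_nhdsWithin] with z hz
    simpa using hz
  filter_upwards [this.eventually h3] with z hz
  rw [hz]
  ring

theorem congr (hf : HasLaurent f n c b a) (hfg : ∀ᶠ z in 𝓝[≠] a, g z = f z) :
    HasLaurent g n c b a := by
  obtain ⟨h, h1, h2, h3⟩ := hf
  refine ⟨h, h1, h2, ?_⟩
  filter_upwards [h3, hfg] with z hz hz'
  rw [hz', hz]

/-- Without a polar term, the constant term is the limit. -/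
theorem tendsto (hf : HasLaurent f n 0 b a) : Tendsto f (𝓝[≠] a) (𝓝 b) := by
  obtain ⟨h, h1, h2, h3⟩ := hf
  rw [← h2]
  refine (h1.continuousAt.tendsto.mono_left nhdsWithin_le_nhds).congr' ?_
  filter_upwards [h3] with z hz
  simp [hz]

/-- With a polar term, the function tends to infinity. -/
theorem tendsto_cobounded (hf : HasLaurent f n c b a) (hc : c ≠ 0) (hn : n ≠ 0) :
    Tendsto f (𝓝[≠] a) (Bornology.cobounded ℂ) := by
  obtain ⟨h, h1, h2, h3⟩ := hf
  apply tendsto_cobounded_of_meromorphicOrderAt_neg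
  have hm : MeromorphicAt (fun z => c / (z - a) ^ n + h z) a := by
    have := h1.meromorphicAt
    fun_prop
  have : meromorphicOrderAt f a = ((-n : ℤ) : WithTop ℤ) := by
    rw [meromorphicOrderAt_congr h3, meromorphicOrderAt_eq_int_iff hm]
    refine ⟨fun z => c + (z - a) ^ n * h z, by fun_prop, by simpa [hn] using hc, ?_⟩
    filter_upwards [self_mem_nhdsWithin] with z hz
    have : (z - a) ^ n ≠ 0 := pow_ne_zero _ (sub_ne_zero.mpr hz)
    rw [zpow_neg, zpow_natCast, smul_eq_mul]
    field_simp
  rw [this]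
  norm_cast
  omega

end HasLaurent

/-- Liouville's theorem for elliptic functions: a function which is periodic with respect to a
lattice, has only removable singularities and tends to `0` at `0` vanishes wherever it is
analytic. -/
theorem eq_zero_of_periodic_of_hasLaurent (Λ : Submodule ℤ ℂ) [DiscreteTopology Λ]
    [IsZLattice ℝ Λ] {f : ℂ → ℂ} {n : ℕ} (hper : ∀ z, ∀ v ∈ Λ, f (z + v) = f z)
    (hreg : ∀ a, ∃ b, HasLaurent f n 0 b a) (h0 : HasLaurent f n 0 0 0) {a : ℂ}
    (ha : AnalyticAt ℂ f a) : f a = 0 := by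
  -- The limits of `f` at all points make up an entire function.
  choose F hF using hreg
  have uniq : ∀ a b, HasLaurent f n 0 b a → F a = b := fun a b h =>
    tendsto_nhds_unique (hF a).tendsto h.tendsto
  have hFd : Differentiable ℂ F := by
    intro a
    obtain ⟨h, h1, h2, h3⟩ := hF a
    have hev : F =ᶠ[𝓝 a] h := by
      have h4 : ∀ᶠ z in 𝓝 a, z ≠ a → f z = h z := by
        rw [eventually_nhdsWithin_iff] at h3
        filter_upwards [h3] with z hz hza
        simpa using hz hza
      filter_upwards [h4.eventually_nhds, h1.eventually_analyticAt] with z hz hza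
      by_cases hzz : z = a
      · rw [hzz, h2]
      · refine uniq z _ ⟨h, hza, rfl, ?_⟩
        filter_upwards [nhdsWithin_le_nhds hz, nhdsWithin_le_nhds (isOpen_ne.mem_nhds hzz)]
          with x hx hxa
        simpa using hx hxa
    exact (h1.congr hev.symm).differentiableAt
  have hFper : ∀ z w, w ∈ Λ → F (z + w) = F z := by
    intro z w hw
    refine uniq _ _ ?_
    have : HasLaurent (fun x => f (x - w)) n 0 (F z) (z + w) :=
      HasLaurent.comp_sub (by simpa using hF z)
    refine this.congr (Eventually.of_forall fun x => ?_)
    rw [← hper (x - w) w hw, sub_add_cancel]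
  have hconst := hFd.apply_eq_apply_of_bounded
    (IsZLattice.isCompact_range_of_periodic Λ F hFd.continuous hFper).isBounded a 0
  rw [← uniq a _ (HasLaurent.of_analyticAt ha n), hconst, uniq 0 0 h0]

/-! ### Derivatives of logarithmic derivatives -/

open Nat in
theorem iteratedDeriv_const_div_sub (k : ℕ) (m a z : ℂ) :
    iteratedDeriv k (fun x => m / (x - a)) z = m * (-1) ^ k * k ! / (z - a) ^ (k + 1) := by
  have h1 : (fun x : ℂ => m / (x - a)) = fun x => m * (1 * x - a)⁻¹ := by
    ext x
    rw [one_mul, div_eq_mul_inv]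
  rw [h1, iteratedDeriv_const_mul_field, iteratedDeriv_eq_iterate, iter_deriv_inv_linear_sub,
    show (-1 - k : ℤ) = -((k + 1 : ℕ) : ℤ) by push_cast; ring]
  simp only [one_pow, one_mul, mul_one, zpow_neg, zpow_natCast]
  ring

open Nat in
theorem iteratedDeriv_sub_pow_mul {B : ℂ → ℂ} {a : ℂ} (hB : AnalyticAt ℂ B a) (m : ℕ) :
    iteratedDeriv m (fun z => (z - a) ^ m * B z) a = m ! * B a := by
  induction m generalizing B with
  | zero => simp
  | succ m ih =>
    have h1 : deriv (fun z => (z - a) ^ (m + 1) * B z) =ᶠ[𝓝 a]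
        fun z => (z - a) ^ m * ((m + 1) * B z + (z - a) * deriv B z) := by
      filter_upwards [hB.eventually_analyticAt] with z hz
      have h2 : HasDerivAt (fun x : ℂ => x - a) 1 z := (hasDerivAt_id z).sub_const a
      refine ((h2.fun_pow (m + 1)).mul hz.differentiableAt.hasDerivAt).deriv.trans ?_
      simp only [Nat.add_sub_cancel]
      push_cast
      ring
    rw [iteratedDeriv_succ', h1.iteratedDeriv_eq, ih (by fun_prop), Nat.factorial_succ]
    simp only [sub_self]
    push_cast
    ring

open Nat in
/-- Near a zero or pole of order `m`, the only polar term of the `k`-th derivative of the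
logarithmic derivative comes from `m / (z - a)`. -/
theorem hasLaurent_iteratedDeriv_logDeriv {f A : ℂ → ℂ} {a : ℂ} (m : ℤ) (k : ℕ)
    (hA : AnalyticAt ℂ A a) (hA0 : A a ≠ 0) (hf : ∀ᶠ z in 𝓝[≠] a, f z = (z - a) ^ m * A z) :
    HasLaurent (iteratedDeriv k (logDeriv f)) (k + 1) (m * (-1) ^ k * k !)
      (iteratedDeriv k (logDeriv A) a) a := by
  have hlA : ∀ z, AnalyticAt ℂ A z → A z ≠ 0 → AnalyticAt ℂ (logDeriv A) z := fun z hz h0 =>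
    hz.deriv.div hz h0
  refine ⟨iteratedDeriv k (logDeriv A), ?_, rfl, ?_⟩
  · rw [iteratedDeriv_eq_iterate]
    exact (hlA a hA hA0).iterated_deriv k
  have key : ∀ᶠ z in 𝓝 a, A z ≠ 0 ∧ AnalyticAt ℂ A z :=
    (hA.continuousAt.eventually_ne hA0).and hA.eventually_analyticAt
  have hf' : ∀ᶠ z in 𝓝 a, z ≠ a → f z = (z - a) ^ m * A z := by
    rwa [eventually_nhdsWithin_iff] at hf
  filter_upwards [nhdsWithin_le_nhds hf'.eventually_nhds,
    nhdsWithin_le_nhds key.eventually_nhds, self_mem_nhdsWithin] with z h1 h2 hz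
  have hza : ∀ᶠ x in 𝓝 z, x ≠ a := isOpen_ne.mem_nhds hz
  have hfz : ∀ᶠ x in 𝓝 z, f x = (x - a) ^ m * A x := by
    filter_upwards [h1, hza] with x hx hxa using hx hxa
  have hl : logDeriv f =ᶠ[𝓝 z] fun x => m / (x - a) + logDeriv A x := by
    filter_upwards [hfz.eventually_nhds, h2, hza] with x hx hx2 hxa
    have hxa' : x - a ≠ 0 := sub_ne_zero.mpr hxa
    have e1 : logDeriv f x = logDeriv (fun y => (y - a) ^ m * A y) x := by
      rw [logDeriv_apply, logDeriv_apply, EventuallyEq.deriv_eq hx, hx.self_of_nhds]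
    have e2 : logDeriv (fun y : ℂ => (y - a) ^ m) x = m / (x - a) := by
      rw [logDeriv_fun_zpow (f := fun y : ℂ => y - a) (by fun_prop), logDeriv_apply]
      simp [div_eq_mul_inv]
    rw [e1, logDeriv_mul (f := fun y : ℂ => (y - a) ^ m) x (zpow_ne_zero _ hxa') hx2.1 ?_
      hx2.2.differentiableAt, e2]
    exact DifferentiableAt.zpow (by fun_prop) (Or.inl hxa')
  have hAz := h2.self_of_nhds
  rw [hl.iteratedDeriv_eq, iteratedDeriv_fun_add, iteratedDeriv_const_div_sub]
  · refine AnalyticAt.contDiffAt ?_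
    exact analyticAt_const.div (by fun_prop) (sub_ne_zero.mpr hz)
  · exact (hlA z hAz.2 hAz.1).contDiffAt

open Nat in
/-- For `f = c / (z - a) ^ n + s + o(1)` with `n ≥ 1` and `c ≠ 0`, the constant term of the
`(n - 1)`-st derivative of `f' / f` at `a` is `n! s / c`. -/
theorem HasLaurent.iteratedDeriv_logDeriv_of_pole {f : ℂ → ℂ} {k : ℕ} {c s a : ℂ}
    (hf : HasLaurent f (k + 1) c s a) (hc : c ≠ 0) :
    HasLaurent (iteratedDeriv k (logDeriv f)) (k + 1) (-(k + 1) * (-1) ^ k * k !)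
      ((k + 1)! * s / c) a := by
  obtain ⟨h, h1, h2, h3⟩ := hf
  set A : ℂ → ℂ := fun z => c + (z - a) ^ (k + 1) * h z with hA
  have hAan : AnalyticAt ℂ A a := by fun_prop
  have hA0 : A a ≠ 0 := by simpa [hA] using hc
  have hfA : ∀ᶠ z in 𝓝[≠] a, f z = (z - a) ^ (-((k + 1 : ℕ) : ℤ)) * A z := by
    filter_upwards [h3, self_mem_nhdsWithin] with z hz hza
    have : (z - a) ^ (k + 1) ≠ 0 := pow_ne_zero _ (sub_ne_zero.mpr hza)
    rw [hz, zpow_neg, zpow_natCast]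
    simp only [hA]
    field_simp
  have := hasLaurent_iteratedDeriv_logDeriv (-((k + 1 : ℕ) : ℤ)) k hAan hA0 hfA
  have hval : iteratedDeriv k (logDeriv A) a = (k + 1)! * s / c := by
    set B : ℂ → ℂ := fun z => ((k + 1) * h z + (z - a) * deriv h z) / A z with hB
    have hl : logDeriv A =ᶠ[𝓝 a] fun z => (z - a) ^ k * B z := by
      filter_upwards [h1.eventually_analyticAt] with z hz
      have h4 : HasDerivAt (fun x : ℂ => x - a) 1 z := (hasDerivAt_id z).sub_const a
      have h5 : deriv A z = (z - a) ^ k * ((k + 1) * h z + (z - a) * deriv h z) := by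
        refine (((h4.fun_pow (k + 1)).mul hz.differentiableAt.hasDerivAt).const_add
          c).deriv.trans ?_
        simp only [Nat.add_sub_cancel]
        push_cast
        ring
      rw [logDeriv_apply, h5, hB]
      ring
    rw [hl.iteratedDeriv_eq, iteratedDeriv_sub_pow_mul]
    · simp only [hB, hA, sub_self, h2, Nat.factorial_succ]
      push_cast
      simp
      ring
    · have := h1.deriv
      exact AnalyticAt.div (by fun_prop) hAan hA0
  rw [hval] at this
  convert this using 1
  push_cast
  ring

/-! ### Derivatives of the Weierstrass function -/

open Nat in
theorem iteratedDeriv_inv_sq (k : ℕ) {z : ℂ} (hz : z ≠ 0) :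
    iteratedDeriv k (fun x : ℂ => 1 / x ^ 2) z = (-1) ^ k * (k + 1)! / z ^ (k + 2) := by
  have h1 : deriv (fun x : ℂ => (-1) / (x - 0)) =ᶠ[𝓝 z] fun x => 1 / x ^ 2 := by
    filter_upwards [isOpen_ne.mem_nhds hz] with x hx
    have hx' : x ≠ 0 := hx
    have : HasDerivAt (fun x : ℂ => (-1) / (x - 0)) (-1 * (-1 / x ^ 2)) x := by
      simpa [div_eq_mul_inv] using! (hasDerivAt_inv hx').const_mul (-1 : ℂ)
    rw [this.deriv]
    ring
  rw [← h1.iteratedDeriv_eq, ← iteratedDeriv_succ', iteratedDeriv_const_div_sub, sub_zero]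
  ring

/-- The constant term of a Laurent expansion with a single polar term. -/
theorem HasLaurent.laurentConst_eq {f : ℂ → ℂ} {n : ℕ} {c b : ℂ} (hn : n ≠ 0)
    (hf : HasLaurent f n c b 0) : laurentConst f = b := by
  obtain ⟨h, h1, h2, h3⟩ := hf
  apply Tendsto.limUnder_eq
  apply tendsto_const_nhds.congr'
  rw [eventually_nhdsWithin_iff] at h3
  obtain ⟨r, hr, hball⟩ := Metric.eventually_nhds_iff_ball.mp (h3.and h1.eventually_analyticAt)
  filter_upwards [Ioo_mem_nhdsGT hr] with ρ hρ
  have hsub : Metric.closedBall (0 : ℂ) ρ ⊆ Metric.ball 0 r :=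
    Metric.closedBall_subset_ball hρ.2
  have e1 : (∮ z in C(0, ρ), f z / z) =
      ∮ z in C(0, ρ), (c * (z - 0) ^ (-((n + 1 : ℕ) : ℤ)) + (z - 0)⁻¹ • h z) := by
    refine circleIntegral.integral_congr hρ.1.le fun z hz => ?_
    have hz0 : z ≠ 0 := by
      rintro rfl
      simp only [mem_sphere_iff_norm, sub_zero, norm_zero] at hz
      exact hρ.1.ne hz
    rw [(hball z (hsub (Metric.sphere_subset_closedBall hz))).1 hz0, zpow_neg, zpow_natCast,
      smul_eq_mul]
    simp only [sub_zero]
    field_simp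
    ring
  have hnot : (0 : ℂ) ∉ Metric.sphere (0 : ℂ) |ρ| := by
    rw [mem_sphere_iff_norm, sub_zero, norm_zero, abs_of_pos hρ.1]
    exact hρ.1.ne
  have hcont : ContinuousOn h (Metric.closedBall 0 ρ) := fun z hz =>
    (hball z (hsub hz)).2.continuousAt.continuousWithinAt
  have i1 : CircleIntegrable (fun z : ℂ => c * (z - 0) ^ (-((n + 1 : ℕ) : ℤ))) 0 ρ := by
    refine ContinuousOn.circleIntegrable hρ.1.le fun z hz => ?_
    have : z ≠ 0 := by
      rintro rfl
      rw [abs_of_pos hρ.1] at hnot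
      exact hnot hz
    exact (continuousAt_const.mul (ContinuousAt.zpow₀ (by fun_prop) _
      (Or.inl (by simpa using this)))).continuousWithinAt
  have i2 : CircleIntegrable (fun z : ℂ => (z - 0)⁻¹ • h z) 0 ρ := by
    refine ContinuousOn.circleIntegrable hρ.1.le ?_
    refine ContinuousOn.fun_smul (fun z hz => ?_) (hcont.mono Metric.sphere_subset_closedBall)
    have : z ≠ 0 := by
      rintro rfl
      rw [abs_of_pos hρ.1] at hnot
      exact hnot hz
    exact (ContinuousAt.inv₀ (by fun_prop) (by simpa using this)).continuousWithinAt
  rw [e1, circleIntegral.integral_add i1 i2, circleIntegral.integral_const_mul,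
    circleIntegral.integral_sub_zpow_of_ne (by omega),
    Complex.circleIntegral_sub_inv_smul_of_differentiable_on_off_countable
      Set.countable_empty (Metric.mem_ball_self hρ.1) hcont
      (fun z hz => (hball z (hsub (Metric.ball_subset_closedBall hz.1))).2.differentiableAt), h2]
  have : (2 * (Real.pi : ℂ) * Complex.I) ≠ 0 := by simp [Real.pi_ne_zero]
  simp only [smul_eq_mul]
  field_simp
  ring

namespace PeriodPair

variable (L : PeriodPair) (k : ℕ)

/-- The `k`-th derivative of the Weierstrass function of `L`. It has a pole of order `k + 2` at
each lattice point, and it is the function `S_Λ` belonging to the group of `(k + 2)`-nd roots of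
unity. -/
noncomputable def sFun : ℂ → ℂ := iteratedDeriv k L.weierstrassP

open Nat in
/-- The coefficient of `z ^ (-(k + 2))` in the Laurent expansion of `L.sFun k` at `0`. -/
noncomputable def sCoeff : ℂ := (-1) ^ k * (k + 1)!

theorem sCoeff_ne_zero : sCoeff k ≠ 0 := by
  simp [sCoeff, Nat.factorial_ne_zero]

theorem sFun_add {v : ℂ} (hv : v ∈ L.lattice) (z : ℂ) : L.sFun k (z + v) = L.sFun k z := by
  have h : (fun z => L.weierstrassP (z + v)) = L.weierstrassP :=
    funext fun z => L.weierstrassP_add_coe z ⟨v, hv⟩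
  rw [sFun, ← congrFun (iteratedDeriv_comp_add_const k L.weierstrassP v) z, h]

theorem sFun_sub {v : ℂ} (hv : v ∈ L.lattice) (z : ℂ) : L.sFun k (z - v) = L.sFun k z := by
  rw [← L.sFun_add k hv, sub_add_cancel]

theorem sFun_neg (z : ℂ) : L.sFun k (-z) = (-1) ^ k * L.sFun k z := by
  have h := iteratedDeriv_comp_neg k L.weierstrassP z
  simp only [weierstrassP_neg, smul_eq_mul] at h
  rw [sFun, h, ← mul_assoc, ← mul_pow]
  simp

theorem sq_mul_weierstrassP_root_mul {n : ℕ} (hn : n ≠ 0) (hinv : IsRootInvariant n L.lattice)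
    {ξ : ℂ} (hξ : ξ ^ n = 1) (z : ℂ) :
    ξ ^ 2 * L.weierstrassP (ξ * z) = L.weierstrassP z := by
  have h0 : ξ ≠ 0 := by
    rintro rfl
    simp [hn] at hξ
  have hξ' : ξ⁻¹ ^ n = 1 := by rw [inv_pow, hξ, inv_one]
  let e : L.lattice ≃ L.lattice :=
    { toFun := fun l => ⟨ξ * l, hinv ξ hξ l l.2⟩
      invFun := fun l => ⟨ξ⁻¹ * l, hinv _ hξ' l l.2⟩
      left_inv := fun l => by simp [h0]
      right_inv := fun l => by simp [h0] }
  rw [weierstrassP, weierstrassP, ← e.tsum_eq, ← tsum_mul_left]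
  refine tsum_congr fun l => ?_
  simp only [e, Equiv.coe_fn_mk]
  rw [← mul_sub, mul_pow, mul_pow]
  field_simp

theorem pow_mul_iteratedDeriv_root_mul {n : ℕ} (hn : n ≠ 0)
    (hinv : IsRootInvariant n L.lattice) {ξ : ℂ} (hξ : ξ ^ n = 1) (z : ℂ) :
    ξ ^ (k + 2) * L.sFun k (ξ * z) = L.sFun k z := by
  induction k generalizing z with
  | zero =>
    simpa [sFun] using L.sq_mul_weierstrassP_root_mul hn hinv hξ z
  | succ k ih =>
    have h := congrFun (congrArg deriv (funext ih)) z
    rw [deriv_const_mul_field, deriv_comp_mul_left] at h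
    rw [sFun, iteratedDeriv_succ]
    rw [← sFun, ← h, smul_eq_mul]
    ring

/-- `S_Λ` is invariant under multiplication by roots of unity, at lattice points too. -/
theorem sFun_root_mul {k : ℕ} (hinv : IsRootInvariant (k + 2) L.lattice) {ξ : ℂ}
    (hξ : ξ ^ (k + 2) = 1) (z : ℂ) : L.sFun k (ξ * z) = L.sFun k z := by
  simpa [hξ] using L.pow_mul_iteratedDeriv_root_mul k (by omega) hinv hξ z

theorem mul_deriv_sFun_root_mul {k : ℕ} (hinv : IsRootInvariant (k + 2) L.lattice) {ξ : ℂ}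
    (hξ : ξ ^ (k + 2) = 1) (z : ℂ) :
    ξ * deriv (L.sFun k) (ξ * z) = deriv (L.sFun k) z := by
  have h := congrFun (congrArg deriv (funext (L.sFun_root_mul hinv hξ))) z
  rwa [deriv_comp_mul_left] at h

theorem analyticAt_sFun {z : ℂ} (hz : z ∉ L.lattice) : AnalyticAt ℂ (L.sFun k) z := by
  rw [sFun, iteratedDeriv_eq_iterate]
  exact (L.analyticOnNhd_weierstrassP z hz).iterated_deriv k

theorem eventually_punctured_notMem_lattice (z : ℂ) : ∀ᶠ x in 𝓝[≠] z, x ∉ L.lattice := by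
  filter_upwards [nhdsWithin_le_nhds (L.compl_lattice_sdiff_singleton_mem_nhds z),
    self_mem_nhdsWithin] with x hx hx' hxL
  exact hx ⟨hxL, hx'⟩

theorem hasLaurent_sFun_zero :
    HasLaurent (L.sFun k) (k + 2) (sCoeff k)
      (iteratedDeriv k (L.weierstrassPExcept 0) 0) 0 := by
  have hE := L.analyticAt_weierstrassPExcept 0
  refine ⟨iteratedDeriv k (L.weierstrassPExcept 0), ?_, rfl, ?_⟩
  · rw [iteratedDeriv_eq_iterate]
    exact hE.iterated_deriv k
  have hP : L.weierstrassP = fun z => 1 / z ^ 2 + L.weierstrassPExcept 0 z := by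
    ext z
    rw [← L.weierstrassPExcept_add 0 z]
    simp
    ring
  filter_upwards [nhdsWithin_le_nhds hE.eventually_analyticAt, self_mem_nhdsWithin] with z hz hz0
  rw [sFun, hP, iteratedDeriv_fun_add ?_ hz.contDiffAt, iteratedDeriv_inv_sq k hz0, sub_zero,
    sCoeff]
  refine AnalyticAt.contDiffAt (analyticAt_const.div (by fun_prop) ?_)
  exact pow_ne_zero _ hz0

/-- At every lattice point, the Laurent expansion of `S_Λ` has a single polar term. -/
theorem hasLaurent_sFun {v : ℂ} (hv : v ∈ L.lattice) :
    HasLaurent (L.sFun k) (k + 2) (sCoeff k) (laurentConst (L.sFun k)) v := by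
  rw [(L.hasLaurent_sFun_zero k).laurentConst_eq (by omega)]
  have : HasLaurent (fun z => L.sFun k (z - v)) (k + 2) (sCoeff k)
      (iteratedDeriv k (L.weierstrassPExcept 0) 0) v :=
    HasLaurent.comp_sub (by simpa using L.hasLaurent_sFun_zero k)
  exact this.congr (Eventually.of_forall fun z => (L.sFun_sub k hv z).symm)

/-- The Laurent expansion of `S_Λ` at an arbitrary point. -/
theorem exists_hasLaurent_sFun [DecidablePred (· ∈ L.lattice)] (a : ℂ) :
    ∃ b, HasLaurent (L.sFun k) (k + 2) (if a ∈ L.lattice then sCoeff k else 0) b a := by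
  split_ifs with h
  · exact ⟨_, L.hasLaurent_sFun k h⟩
  · exact ⟨_, HasLaurent.of_analyticAt (L.analyticAt_sFun k h) _⟩

theorem meromorphic_sFun : Meromorphic (L.sFun k) := by
  intro a
  classical
  obtain ⟨b, h, h1, -, h3⟩ := L.exists_hasLaurent_sFun k a
  refine MeromorphicAt.congr (f := fun z =>
    (if a ∈ L.lattice then sCoeff k else 0) / (z - a) ^ (k + 2) + h z) ?_ ?_
  · have := h1.meromorphicAt
    fun_prop
  · filter_upwards [h3] with z hz using hz.symm

/-- The constant term of `S_Λ` vanishes when `S_Λ` is odd. -/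
theorem neg_one_pow_mul_laurentConst_sFun :
    (-1) ^ k * laurentConst (L.sFun k) = laurentConst (L.sFun k) := by
  rw [(L.hasLaurent_sFun_zero k).laurentConst_eq (by omega)]
  have h := iteratedDeriv_comp_neg k (L.weierstrassPExcept 0) 0
  have h2 : (fun z => L.weierstrassPExcept 0 (-z)) = L.weierstrassPExcept 0 := by
    ext z
    rw [L.weierstrassPExcept_neg, neg_zero]
  rw [h2, neg_zero, smul_eq_mul] at h
  exact h.symm

theorem laurentConst_weierstrassP : laurentConst L.weierstrassP = 0 := by
  have := (L.hasLaurent_sFun_zero 0).laurentConst_eq (by omega)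
  simpa [sFun] using this

end PeriodPair

/-! ### Fibres over a neighbourhood of infinity -/

/-- An analytic function with non-vanishing derivative is injective near the point. -/
theorem AnalyticAt.exists_ball_injOn {f : ℂ → ℂ} {a : ℂ} (hf : AnalyticAt ℂ f a)
    (h0 : deriv f a ≠ 0) : ∃ r > 0, Set.InjOn f (Metric.ball a r) := by
  have h1 := (hf.hasStrictDerivAt.hasStrictFDerivAt_equiv h0)
  obtain ⟨s, hs, hso, happ⟩ := h1.approximates_deriv_on_open_nhds
  obtain ⟨r, hr, hrs⟩ := Metric.isOpen_iff.mp hso a hs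
  refine ⟨r, hr, (happ.injOn (Or.inr ?_)).mono hrs⟩
  refine NNReal.half_lt_self ?_
  exact inv_ne_zero (ContinuousLinearEquiv.nnnorm_symm_pos _).ne'

namespace PeriodPair

variable (L : PeriodPair) {k : ℕ}

/-- `S_Λ` is bounded away from the lattice. -/
theorem exists_norm_sFun_le (k : ℕ) {ε : ℝ} (hε : 0 < ε) :
    ∃ M, ∀ u, (∀ v ∈ L.lattice, ε ≤ ‖u - v‖) → ‖L.sFun k u‖ ≤ M := by
  set r : ℝ := ∑ i, ‖L.basis i‖
  set K : Set ℂ := Metric.closedBall 0 r ∩ {u | ∀ v ∈ L.lattice, ε ≤ ‖u - v‖} with hK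
  have hKc : IsCompact K := by
    refine (isCompact_closedBall 0 r).inter_right ?_
    simp only [Set.ofPred_forall]
    exact isClosed_iInter fun v => isClosed_iInter fun _ =>
      isClosed_le continuous_const (by fun_prop)
  have hcont : ContinuousOn (L.sFun k) K := fun u hu => by
    refine (L.analyticAt_sFun k fun hL => ?_).continuousAt.continuousWithinAt
    have := hu.2 u hL
    simp only [sub_self, norm_zero] at this
    linarith
  obtain ⟨M, hM⟩ := hKc.exists_bound_of_continuousOn hcont
  refine ⟨M, fun u hu => ?_⟩
  -- Translate `u` into a fundamental parallelogram.
  set w : ℂ := (ZSpan.floor L.basis u : ℂ)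
  have hw : w ∈ L.lattice := by
    rw [L.lattice_eq_span_range_basis]
    exact (ZSpan.floor L.basis u).2
  rw [← L.sFun_sub k hw]
  refine hM _ ⟨?_, fun v hv => ?_⟩
  · rw [mem_closedBall_zero_iff]
    exact ZSpan.norm_fract_le (K := ℝ) L.basis u
  · rw [sub_sub]
    exact hu _ (L.lattice.add_mem hw hv)

theorem tendsto_sFun_cobounded (k : ℕ) {v : ℂ} (hv : v ∈ L.lattice) :
    Tendsto (L.sFun k) (𝓝[≠] v) (Bornology.cobounded ℂ) :=
  (L.hasLaurent_sFun k hv).tendsto_cobounded (sCoeff_ne_zero k) (by omega)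

/-- Near `0` the fibres of `S_Λ` are orbits of the roots of unity: `S_Λ = c ψ ^ (-(k + 2))` for a
local coordinate `ψ` which commutes with the roots of unity. -/
theorem exists_ball_fibre (hinv : IsRootInvariant (k + 2) L.lattice) :
    ∃ r > 0, ∀ z ∈ Metric.ball (0 : ℂ) r, ∀ u ∈ Metric.ball (0 : ℂ) r, z ≠ 0 → u ≠ 0 →
      L.sFun k u = L.sFun k z → ∃ ξ : ℂ, ξ ^ (k + 2) = 1 ∧ u = ξ * z := by
  obtain ⟨h, h1, -, h3⟩ := L.hasLaurent_sFun k L.lattice.zero_mem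
  set c := sCoeff k with hc
  have hc0 : c ≠ 0 := sCoeff_ne_zero k
  -- `S_Λ = c A / z ^ (k + 2)`, and `B = A ^ (-1 / (k + 2))`.
  set A : ℂ → ℂ := fun z => 1 + z ^ (k + 2) * h z / c with hA
  have hA0 : A 0 = 1 := by simp [hA]
  have hAan : AnalyticAt ℂ A 0 := by fun_prop
  set B : ℂ → ℂ := fun z => Complex.exp (-Complex.log (A z) / (k + 2 : ℕ)) with hB
  set ψ : ℂ → ℂ := fun z => z * B z with hψ
  have hBan : AnalyticAt ℂ B 0 := by
    have : AnalyticAt ℂ (fun z => Complex.log (A z)) 0 :=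
      hAan.clog (by rw [hA0]; exact Complex.one_mem_slitPlane)
    have h2 : ((k + 2 : ℕ) : ℂ) ≠ 0 := by exact_mod_cast (by omega : k + 2 ≠ 0)
    exact (this.neg.div analyticAt_const h2).cexp
  have hψan : AnalyticAt ℂ ψ 0 := analyticAt_id.mul hBan
  have hψ' : deriv ψ 0 ≠ 0 := by
    have : HasDerivAt ψ (1 * B 0 + 0 * deriv B 0) 0 :=
      (hasDerivAt_id (0 : ℂ)).mul hBan.differentiableAt.hasDerivAt
    rw [this.deriv]
    simp [hB]
  obtain ⟨r₁, hr₁, hinj⟩ := hψan.exists_ball_injOn hψ'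
  have hAne : ∀ᶠ z in 𝓝 (0 : ℂ), A z ≠ 0 :=
    hAan.continuousAt.eventually_ne (by rw [hA0]; exact one_ne_zero)
  rw [eventually_nhdsWithin_iff] at h3
  obtain ⟨r₂, hr₂, hball⟩ := Metric.eventually_nhds_iff_ball.mp (h3.and hAne)
  refine ⟨min r₁ r₂, lt_min hr₁ hr₂, fun z hz u hu hz0 hu0 huz => ?_⟩
  have hz1 := Metric.ball_subset_ball (min_le_left r₁ r₂) hz
  have hu1 := Metric.ball_subset_ball (min_le_left r₁ r₂) hu
  have hS : ∀ x ∈ Metric.ball (0 : ℂ) r₂, x ≠ 0 → A x = x ^ (k + 2) * L.sFun k x / c := by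
    intro x hx hx0
    rw [(hball x hx).1 hx0, hA, sub_zero]
    field_simp
  have hBpow : ∀ x ∈ Metric.ball (0 : ℂ) r₂, B x ^ (k + 2) = (A x)⁻¹ := by
    intro x hx
    rw [hB, ← Complex.exp_nat_mul, mul_div_cancel₀ _ (by exact_mod_cast (by omega : k + 2 ≠ 0)),
      Complex.exp_neg, Complex.exp_log (hball x hx).2]
  have hz2 := Metric.ball_subset_ball (min_le_right r₁ r₂) hz
  have hu2 := Metric.ball_subset_ball (min_le_right r₁ r₂) hu
  have hψpow : ∀ x ∈ Metric.ball (0 : ℂ) r₂, x ≠ 0 → ψ x ^ (k + 2) * L.sFun k x = c := by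
    intro x hx hx0
    have hAx := (hball x hx).2
    rw [hψ, mul_pow, hBpow x hx]
    have e := hS x hx hx0
    have e' : x ^ (k + 2) * L.sFun k x = A x * c := by
      rw [e]
      field_simp
    calc x ^ (k + 2) * (A x)⁻¹ * L.sFun k x = (x ^ (k + 2) * L.sFun k x) * (A x)⁻¹ := by ring
      _ = c := by
        rw [e']
        field_simp
  have hψ0 : ψ z ≠ 0 := mul_ne_zero hz0 (Complex.exp_ne_zero _)
  have hpow : ψ u ^ (k + 2) = ψ z ^ (k + 2) := by
    have e1 := hψpow z hz2 hz0
    have e2 := hψpow u hu2 hu0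
    rw [huz] at e2
    have hSz : L.sFun k z ≠ 0 := by
      intro h0
      rw [h0, mul_zero] at e1
      exact hc0 e1.symm
    exact mul_right_cancel₀ hSz (e2.trans e1.symm)
  set ξ := ψ u / ψ z with hξdef
  have hξ : ξ ^ (k + 2) = 1 := by
    rw [hξdef, div_pow, hpow, div_self (pow_ne_zero _ hψ0)]
  refine ⟨ξ, hξ, ?_⟩
  have hnorm : ‖ξ‖ = 1 := Complex.norm_eq_one_of_pow_eq_one hξ (by omega)
  have hξ0 : ξ ≠ 0 := by
    rw [← norm_ne_zero_iff, hnorm]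
    exact one_ne_zero
  have hmem : ∀ r, z ∈ Metric.ball (0 : ℂ) r → ξ * z ∈ Metric.ball (0 : ℂ) r := by
    intro r hzr
    rw [mem_ball_zero_iff] at hzr ⊢
    rwa [norm_mul, hnorm, one_mul]
  refine hinj hu1 (hmem _ hz1) ?_
  have hAξ : A (ξ * z) = A z := by
    rw [hS _ (hmem _ hz2) (mul_ne_zero hξ0 hz0), hS z hz2 hz0, L.sFun_root_mul hinv hξ, mul_pow,
      hξ, one_mul]
  have hψξ : ψ (ξ * z) = ξ * ψ z := by
    simp only [hψ, hB, hAξ]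
    ring
  rw [hψξ, hξdef, div_mul_cancel₀ _ hψ0]

theorem meromorphicOrderAt_sFun_sub_ne_top (k : ℕ) (w a : ℂ) :
    meromorphicOrderAt (fun z => L.sFun k z - w) a ≠ ⊤ := by
  have hm : MeromorphicOn (fun z => L.sFun k z - w) Set.univ := fun x _ =>
    (L.meromorphic_sFun k x).fun_sub (MeromorphicAt.const w x)
  refine hm.meromorphicOrderAt_ne_top_of_isPreconnected isPreconnected_univ (Set.mem_univ 0)
    (Set.mem_univ a) fun h => ?_
  rw [meromorphicOrderAt_eq_top_iff] at h
  have h1 := (L.tendsto_sFun_cobounded k L.lattice.zero_mem).eventually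
    (Bornology.eventually_ne_cobounded w)
  obtain ⟨x, hx, hx'⟩ := (h.and h1).exists
  exact hx' (sub_eq_zero.mp hx)

theorem eventually_sFun_ne (k : ℕ) (w a : ℂ) : ∀ᶠ z in 𝓝[≠] a, L.sFun k z ≠ w := by
  have hm : MeromorphicAt (fun z => L.sFun k z - w) a :=
    (L.meromorphic_sFun k a).fun_sub (MeromorphicAt.const w a)
  filter_upwards [(meromorphicOrderAt_ne_top_iff_eventually_ne_zero hm).mp
    (L.meromorphicOrderAt_sFun_sub_ne_top k w a)] with z hz h
  exact hz (sub_eq_zero.mpr h)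

theorem eventually_deriv_sFun_ne_zero (k : ℕ) : ∀ᶠ z in 𝓝[≠] (0 : ℂ), deriv (L.sFun k) z ≠ 0 := by
  have h := (L.tendsto_sFun_cobounded (k + 1) L.lattice.zero_mem).eventually
    (Bornology.eventually_ne_cobounded 0)
  filter_upwards [h] with z hz
  rwa [sFun, iteratedDeriv_succ] at hz

/-- For `z ≠ 0` close to `0`, the fibre of `S_Λ` through `z` consists of the lattice translates of
the multiples of `z` by roots of unity. -/
theorem eventually_fibre (hinv : IsRootInvariant (k + 2) L.lattice) :
    ∀ᶠ z in 𝓝[≠] (0 : ℂ), ∀ u ∉ L.lattice, L.sFun k u = L.sFun k z →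
      ∃ ξ : ℂ, ξ ^ (k + 2) = 1 ∧ u - ξ * z ∈ L.lattice := by
  obtain ⟨r, hr, hfib⟩ := L.exists_ball_fibre hinv
  obtain ⟨M, hM⟩ := L.exists_norm_sFun_le k hr
  have h1 : ∀ᶠ z in 𝓝[≠] (0 : ℂ), M < ‖L.sFun k z‖ :=
    (tendsto_norm_atTop_iff_cobounded.mpr
      (L.tendsto_sFun_cobounded k L.lattice.zero_mem)).eventually_gt_atTop M
  filter_upwards [h1, self_mem_nhdsWithin, nhdsWithin_le_nhds (Metric.ball_mem_nhds 0 hr)]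
    with z hz hz0 hzr u hu huz
  have : ∃ v ∈ L.lattice, ‖u - v‖ < r := by
    by_contra! hcon
    have := hM u hcon
    rw [huz] at this
    linarith
  obtain ⟨v, hv, hvr⟩ := this
  obtain ⟨ξ, hξ, h⟩ := hfib z hzr (u - v) (by simpa using hvr) hz0
    (fun h => hu (by rwa [sub_eq_zero.mp h])) (by rw [L.sFun_sub k hv, huz])
  refine ⟨ξ, hξ, ?_⟩
  rw [← h]
  simpa using hv

end PeriodPair

/-! ### The derivative of the logarithm as a sum over an orbit -/

/-- An analytic function with a simple zero is `z - a` times a non-vanishing function. -/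
theorem AnalyticAt.exists_eq_sub_mul {f : ℂ → ℂ} {a : ℂ} (hf : AnalyticAt ℂ f a) (h0 : f a = 0)
    (h1 : deriv f a ≠ 0) :
    ∃ A : ℂ → ℂ, AnalyticAt ℂ A a ∧ A a ≠ 0 ∧ ∀ᶠ z in 𝓝[≠] a, f z = (z - a) ^ (1 : ℤ) * A z := by
  have := hf.analyticOrderAt_eq_one_of_zero_deriv_ne_zero h0 h1
  obtain ⟨A, hA, hA0, h⟩ := (hf.analyticOrderAt_eq_natCast (n := 1)).mp (by simpa using this)
  refine ⟨A, hA, hA0, ?_⟩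
  filter_upwards [nhdsWithin_le_nhds h] with z hz
  simpa using hz

theorem card_nthRootsFinset_one {n : ℕ} (hn : n ≠ 0) :
    (Polynomial.nthRootsFinset n (1 : ℂ)).card = n :=
  (Complex.isPrimitiveRoot_exp n hn).card_nthRootsFinset

/-- Inversion permutes the roots of unity. -/
theorem sum_nthRootsFinset_inv {n : ℕ} (hn : 0 < n) (g : ℂ → ℂ) :
    ∑ ξ ∈ Polynomial.nthRootsFinset n (1 : ℂ), g ξ⁻¹ =
      ∑ ξ ∈ Polynomial.nthRootsFinset n (1 : ℂ), g ξ := by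
  have hmem : ∀ ξ ∈ Polynomial.nthRootsFinset n (1 : ℂ),
      ξ⁻¹ ∈ Polynomial.nthRootsFinset n (1 : ℂ) := fun ξ h => by
    rw [Polynomial.mem_nthRootsFinset hn] at h ⊢
    rw [inv_pow, h, inv_one]
  exact Finset.sum_nbij' (fun ξ => ξ⁻¹) (fun ξ => ξ⁻¹) hmem hmem (fun ξ _ => inv_inv ξ)
    (fun ξ _ => inv_inv ξ) fun ξ _ => rfl

namespace PeriodPair

variable (L : PeriodPair) {k : ℕ}

/-- The sum over the roots of unity `ξ` of `S_Λ (z - ξ u) - S_Λ (-ξ u)`. As a function of `z` it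
has poles at the points of the orbit of `u` only, and it vanishes at `0`. -/
noncomputable def orbitSum (L : PeriodPair) (k : ℕ) (u z : ℂ) : ℂ :=
  ∑ ξ ∈ Polynomial.nthRootsFinset (k + 2) (1 : ℂ), (L.sFun k (z - ξ * u) - L.sFun k (-(ξ * u)))

/-- `orbitSum` as a function of `u`. -/
theorem orbitSum_eq (hinv : IsRootInvariant (k + 2) L.lattice) (u z : ℂ) :
    L.orbitSum k u z = (-1) ^ k * (∑ ξ ∈ Polynomial.nthRootsFinset (k + 2) (1 : ℂ),
      L.sFun k (u - ξ * z) - (k + 2) * L.sFun k u) := by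
  have hroot : ∀ ξ ∈ Polynomial.nthRootsFinset (k + 2) (1 : ℂ), ξ ^ (k + 2) = 1 := fun ξ h =>
    (Polynomial.mem_nthRootsFinset (by omega) 1).mp h
  rw [orbitSum, Finset.sum_sub_distrib, mul_sub, Finset.mul_sum,
    ← sum_nthRootsFinset_inv (by omega) fun ξ => (-1) ^ k * L.sFun k (u - ξ * z)]
  congr 1
  · refine Finset.sum_congr rfl fun ξ hξ => ?_
    have h0 : ξ ≠ 0 := Polynomial.ne_zero_of_mem_nthRootsFinset one_ne_zero hξ
    rw [← L.sFun_root_mul hinv (hroot ξ hξ) (u - ξ⁻¹ * z), ← L.sFun_neg]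
    congr 1
    field_simp
    ring
  · rw [Finset.sum_congr rfl fun ξ hξ => by
      rw [L.sFun_neg, L.sFun_root_mul hinv (hroot ξ hξ)], Finset.sum_const,
      card_nthRootsFinset_one (by omega), nsmul_eq_mul]
    push_cast
    ring

/-- A point at which the derivative of `S_Λ` does not vanish is fixed modulo `Λ` by no non-trivial
root of unity. -/
theorem eq_one_of_root_mul_sub_mem (hinv : IsRootInvariant (k + 2) L.lattice) {z ξ : ℂ}
    (hz : deriv (L.sFun k) z ≠ 0) (hξ : ξ ^ (k + 2) = 1) (h : ξ * z - z ∈ L.lattice) : ξ = 1 := by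
  have h1 := L.mul_deriv_sFun_root_mul hinv hξ z
  have h2 : deriv (L.sFun k) (ξ * z) = deriv (L.sFun k) z := by
    have h3 := L.sFun_add (k + 1) h z
    rw [add_sub_cancel] at h3
    simpa only [sFun, iteratedDeriv_succ] using h3
  rw [h2] at h1
  exact mul_right_cancel₀ hz (h1.trans (one_mul _).symm)

open Nat in
/-- The `(k + 2)`-nd derivative of `log (S_Λ u - S_Λ z)` with respect to `u`, for `z` close to `0`:
as functions of `u`, both sides are elliptic with the same polar terms, and they have the same
constant term at `0`. -/
theorem eventually_iteratedDerivLog_eq_orbitSum (hinv : IsRootInvariant (k + 2) L.lattice) :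
    ∀ᶠ z in 𝓝[≠] (0 : ℂ), ∀ u ∉ L.lattice, L.sFun k u ≠ L.sFun k z →
      (-1) ^ (k + 3) * iteratedDerivLog (k + 2) (fun v => L.sFun k v - L.sFun k z) u =
        L.orbitSum k u z := by
  classical
  filter_upwards [L.eventually_fibre hinv, L.eventually_deriv_sFun_ne_zero k,
    L.eventually_punctured_notMem_lattice 0] with z hfib hdz hz u hu huz
  set w := L.sFun k z with hw
  set W := Polynomial.nthRootsFinset (k + 2) (1 : ℂ) with hW
  have hroot : ∀ ξ ∈ W, ξ ^ (k + 2) = 1 := fun ξ h =>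
    (Polynomial.mem_nthRootsFinset (by omega) 1).mp h
  set f : ℂ → ℂ := fun v => L.sFun k v - w with hf
  set D : ℂ → ℂ := fun v => (-1) ^ (k + 3) * iteratedDeriv (k + 1) (logDeriv f) v -
    (-1) ^ k * (∑ ξ ∈ W, L.sFun k (v - ξ * z) - (k + 2) * L.sFun k v) with hD
  suffices hD0 : D u = 0 by
    rw [orbitSum_eq L hinv]
    exact sub_eq_zero.mp hD0
  have hsgn : ((-1 : ℂ) ^ k) * (-1) ^ k = 1 := by
    rw [← mul_pow]
    simp
  have hfper : ∀ v ∈ L.lattice, (fun x => f (x + v)) = f := fun v hv =>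
    funext fun x => by simp only [hf, L.sFun_add k hv]
  have hlper : ∀ v ∈ L.lattice, (fun x => logDeriv f (x + v)) = logDeriv f := fun v hv => by
    ext x
    have := deriv_comp_add_const f v x
    rw [hfper v hv] at this
    rw [logDeriv_apply, logDeriv_apply, this, ← congrFun (hfper v hv) x]
  have hper : ∀ x, ∀ v ∈ L.lattice, D (x + v) = D x := by
    intro x v hv
    have h1 := congrFun (iteratedDeriv_comp_add_const (k + 1) (logDeriv f) v) x
    rw [hlper v hv] at h1
    simp only [hD, L.sFun_add k hv, ← h1, add_sub_right_comm]
  have hξz : ∀ ξ ∈ W, ξ * z ∉ L.lattice := by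
    intro ξ hξ h
    have h0 : ξ ≠ 0 := Polynomial.ne_zero_of_mem_nthRootsFinset one_ne_zero hξ
    have := hinv ξ⁻¹ (by rw [inv_pow, hroot ξ hξ, inv_one]) _ h
    rw [inv_mul_cancel_left₀ h0] at this
    exact hz this
  have hSξ : ∀ ξ ∈ W, ∀ v, v - ξ * z ∈ L.lattice → L.sFun k v = w := by
    intro ξ hξ v hv
    rw [← L.sFun_sub k hv v, sub_sub_cancel, L.sFun_root_mul hinv (hroot ξ hξ)]
  have hanF : ∀ v ∉ L.lattice, AnalyticAt ℂ f v := fun v hv =>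
    (L.analyticAt_sFun k hv).sub analyticAt_const
  have hsum : ∀ v, (∀ ξ ∈ W, v - ξ * z ∉ L.lattice) →
      HasLaurent (fun v => ∑ ξ ∈ W, L.sFun k (v - ξ * z)) (k + 2) 0
        (∑ ξ ∈ W, L.sFun k (v - ξ * z)) v := by
    intro v hv
    refine HasLaurent.of_analyticAt (Finset.analyticAt_fun_sum _ fun ξ hξ => ?_) _
    exact (L.analyticAt_sFun k (hv ξ hξ)).comp_of_eq (by fun_prop) rfl
  have hreg : ∀ v ∉ L.lattice, L.sFun k v ≠ w → AnalyticAt ℂ D v := by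
    intro v hv hvw
    have h1 : AnalyticAt ℂ (logDeriv f) v := (hanF v hv).deriv.div (hanF v hv)
      (sub_ne_zero.mpr hvw)
    have h2 : AnalyticAt ℂ (iteratedDeriv (k + 1) (logDeriv f)) v := by
      rw [iteratedDeriv_eq_iterate]
      exact h1.iterated_deriv _
    have h3 : AnalyticAt ℂ (fun v => ∑ ξ ∈ W, L.sFun k (v - ξ * z)) v := by
      refine Finset.analyticAt_fun_sum _ fun ξ hξ => ?_
      refine (L.analyticAt_sFun k fun h => hvw (hSξ ξ hξ v h)).comp_of_eq (by fun_prop) rfl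
    have h4 := L.analyticAt_sFun k hv
    fun_prop
  -- The polar terms and the constant term at a lattice point.
  have hlat : ∀ v ∈ L.lattice, HasLaurent D (k + 2) 0 (((-1) ^ (k + 3) *
      ((k + 2)! * (laurentConst (L.sFun k) - w) / sCoeff k)) - (-1) ^ k *
      (∑ ξ ∈ W, L.sFun k (v - ξ * z) - (k + 2) * laurentConst (L.sFun k))) v := by
    intro v hv
    have h1 := ((L.hasLaurent_sFun k hv).sub_const w).iteratedDeriv_logDeriv_of_pole
      (sCoeff_ne_zero k)
    have h2 := hsum v fun ξ hξ h => hξz ξ hξ (by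
      have := L.lattice.sub_mem hv h
      rwa [sub_sub_cancel] at this)
    have h3 := (h1.const_mul ((-1) ^ (k + 3))).sub
      ((h2.sub ((L.hasLaurent_sFun k hv).const_mul (k + 2))).const_mul ((-1) ^ k))
    convert h3 using 1
    rw [sCoeff]
    push_cast
    ring
  have hD0 : HasLaurent D (k + 2) 0 0 0 := by
    convert hlat 0 L.lattice.zero_mem using 1
    have e1 : ∑ ξ ∈ W, L.sFun k (0 - ξ * z) = (k + 2) * ((-1) ^ k * w) := by
      rw [Finset.sum_congr rfl fun ξ hξ => by
        rw [zero_sub, L.sFun_neg, L.sFun_root_mul hinv (hroot ξ hξ)], Finset.sum_const,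
        card_nthRootsFinset_one (by omega), nsmul_eq_mul]
      push_cast
      ring
    have e2 : (((k + 2)! : ℕ) : ℂ) = (k + 2) * (k + 1)! := by
      rw [Nat.factorial_succ]
      push_cast
      ring
    have e4 : (((k + 2)! : ℕ) : ℂ) * (laurentConst (L.sFun k) - w) / sCoeff k =
        (-1) ^ k * ((k + 2) * (laurentConst (L.sFun k) - w)) := by
      rw [e2, div_eq_iff (sCoeff_ne_zero k), sCoeff]
      linear_combination -((k + 2) * (k + 1)! * (laurentConst (L.sFun k) - w)) * hsgn
    have e5 := L.neg_one_pow_mul_laurentConst_sFun k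
    rw [e1, e4, pow_add]
    linear_combination ((k + 2) * (laurentConst (L.sFun k) - w) + (k + 2) * w) * hsgn
      - (k + 2) * e5
  refine eq_zero_of_periodic_of_hasLaurent L.lattice hper (fun v => ?_) hD0 (hreg u hu huz)
  by_cases hv : v ∈ L.lattice
  · exact ⟨_, hlat v hv⟩
  by_cases hvw : L.sFun k v = w
  swap
  · exact ⟨_, HasLaurent.of_analyticAt (hreg v hv hvw) _⟩
  -- A zero of `S_Λ - w`: it is simple, and it is a pole of exactly one of the summands.
  obtain ⟨η, hη, hηv⟩ := hfib v hv hvw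
  have hηW : η ∈ W := (Polynomial.mem_nthRootsFinset (by omega) 1).mpr hη
  have hη0 : η ≠ 0 := Polynomial.ne_zero_of_mem_nthRootsFinset one_ne_zero hηW
  have hdv : deriv f v ≠ 0 := by
    have h1 : deriv f v = deriv (L.sFun k) v := deriv_sub_const _
    have h2 := L.sFun_sub (k + 1) hηv v
    rw [sub_sub_cancel] at h2
    simp only [sFun, iteratedDeriv_succ] at h2
    rw [h1, sFun, ← h2]
    have h3 := L.mul_deriv_sFun_root_mul hinv hη z
    intro h4
    rw [sFun, h4, mul_zero] at h3
    exact hdz h3.symm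
  obtain ⟨A, hA, hA0, hfA⟩ := (hanF v hv).exists_eq_sub_mul (by simp [hf, hvw]) hdv
  have h1 := hasLaurent_iteratedDeriv_logDeriv 1 (k + 1) hA hA0 hfA
  have h2 : ∀ ξ ∈ W, ∃ b, HasLaurent (fun x => L.sFun k (x - ξ * z)) (k + 2)
      (if ξ = η then sCoeff k else 0) b v := by
    intro ξ hξ
    obtain ⟨b, hb⟩ := L.exists_hasLaurent_sFun k (v - ξ * z)
    refine ⟨b, ?_⟩
    convert hb.comp_sub using 2
    refine ⟨fun h => h ▸ hηv, fun h => ?_⟩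
    have h5 : η⁻¹ * ξ * z - z ∈ L.lattice := by
      have := hinv η⁻¹ (by rw [inv_pow, hη, inv_one]) _ (L.lattice.sub_mem hηv h)
      convert this using 1
      field_simp
      ring
    have := L.eq_one_of_root_mul_sub_mem hinv hdz
      (by rw [mul_pow, inv_pow, hη, hroot ξ hξ, inv_one, one_mul]) h5
    field_simp at this
    exact this
  choose! b hb using h2
  have h3 := (h1.const_mul ((-1) ^ (k + 3))).sub (((HasLaurent.sum hb).sub
    ((HasLaurent.of_analyticAt (L.analyticAt_sFun k hv) (k + 2)).const_mul (k + 2))).const_mul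
      ((-1) ^ k))
  have h4 : (-1 : ℂ) ^ (k + 3) * (((1 : ℤ) : ℂ) * (-1) ^ (k + 1) * (k + 1)!) -
      (-1) ^ k * ((∑ ξ ∈ W, if ξ = η then sCoeff k else 0) - (k + 2) * 0) = 0 := by
    rw [Finset.sum_ite_eq' W η, if_pos hηW, sCoeff]
    push_cast
    ring
  rw [h4] at h3
  exact ⟨_, h3⟩

end PeriodPair

/-! ### The identity for all arguments -/

/-- The derivatives of `f' / (f - w)` are polynomials in `(f - w)⁻¹` without constant term, whose
coefficients do not depend on `w`. -/
theorem exists_iteratedDeriv_logDeriv_sub_eq (f : ℂ → ℂ) (m : ℕ) :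
    ∃ (N : ℕ) (a : ℕ → ℂ → ℂ), (∀ i v, AnalyticAt ℂ f v → AnalyticAt ℂ (a i) v) ∧
      ∀ v w, AnalyticAt ℂ f v → f v ≠ w →
        iteratedDeriv m (logDeriv fun x => f x - w) v =
          ∑ i ∈ Finset.range N, a i v * (f v - w)⁻¹ ^ (i + 1) := by
  induction m with
  | zero =>
    refine ⟨1, fun _ => deriv f, fun _ v hv => hv.deriv, fun v w hv hw => ?_⟩
    simp [logDeriv_apply, div_eq_mul_inv]
  | succ m ih =>
    obtain ⟨N, a, ha, h⟩ := ih
    refine ⟨N + 1, fun i x => (if i < N then deriv (a i) x else 0) - i * a (i - 1) x * deriv f x,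
      fun i v hv => ?_, fun v w hv hw => ?_⟩
    · have h1 := (ha i v hv).deriv
      have h2 := ha (i - 1) v hv
      have h3 := hv.deriv
      dsimp only
      split_ifs <;> fun_prop
    have hev : iteratedDeriv m (logDeriv fun x => f x - w) =ᶠ[𝓝 v]
        fun x => ∑ i ∈ Finset.range N, a i x * (f x - w)⁻¹ ^ (i + 1) := by
      filter_upwards [hv.eventually_analyticAt, hv.continuousAt.eventually_ne hw] with x hx hxw
        using h x w hx hxw
    have hfw : f v - w ≠ 0 := sub_ne_zero.mpr hw
    have hinv : HasDerivAt (fun x => (f x - w)⁻¹) (-deriv f v / (f v - w) ^ 2) v :=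
      (hv.differentiableAt.hasDerivAt.sub_const w).fun_inv hfw
    have hd : HasDerivAt (fun x => ∑ i ∈ Finset.range N, a i x * (f x - w)⁻¹ ^ (i + 1))
        (∑ i ∈ Finset.range N, (deriv (a i) v * (f v - w)⁻¹ ^ (i + 1) +
          a i v * (((i + 1 : ℕ) : ℂ) * (f v - w)⁻¹ ^ i * (-deriv f v / (f v - w) ^ 2)))) v :=
      HasDerivAt.fun_sum fun i _ =>
        (ha i v hv).differentiableAt.hasDerivAt.mul (hinv.fun_pow (i + 1))
    rw [iteratedDeriv_succ, hev.deriv_eq, hd.deriv]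
    simp only [sub_mul, Finset.sum_sub_distrib]
    rw [Finset.sum_range_succ, if_neg (lt_irrefl N), Finset.sum_range_succ' (fun i : ℕ =>
      (i : ℂ) * a (i - 1) v * deriv f v * (f v - w)⁻¹ ^ (i + 1)), Finset.sum_add_distrib]
    simp only [Nat.add_sub_cancel, Nat.cast_zero, zero_mul, add_zero, sub_eq_add_neg]
    congr 1
    · exact Finset.sum_congr rfl fun i hi => by rw [if_pos (Finset.mem_range.mp hi)]
    · rw [← Finset.sum_neg_distrib]
      refine Finset.sum_congr rfl fun i _ => ?_
      rw [div_eq_mul_inv, ← inv_pow]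
      ring

namespace PeriodPair

variable (L : PeriodPair) {k : ℕ}

/-- At every point `a` the Laurent expansion of `orbitSum` has a single polar term, with a
contribution from each root of unity `ξ` with `ξ u ≡ a`. -/
theorem exists_hasLaurent_orbitSum [DecidablePred (· ∈ L.lattice)] (k : ℕ) (u a : ℂ) :
    ∃ b, HasLaurent (L.orbitSum k u) (k + 2)
      (((Polynomial.nthRootsFinset (k + 2) (1 : ℂ)).filter fun ξ => a - ξ * u ∈ L.lattice).card *
        sCoeff k) b a := by
  choose b hb using fun ξ : ℂ => L.exists_hasLaurent_sFun k (a - ξ * u)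
  have := HasLaurent.sum (s := Polynomial.nthRootsFinset (k + 2) (1 : ℂ)) fun ξ _ =>
    ((hb ξ).comp_sub).sub_const (L.sFun k (-(ξ * u)))
  rw [Finset.sum_ite, Finset.sum_const_zero, add_zero, Finset.sum_const, nsmul_eq_mul] at this
  exact ⟨_, this⟩

theorem analyticAt_orbitSum {u z : ℂ} (h : ∀ ξ : ℂ, ξ ^ (k + 2) = 1 → z - ξ * u ∉ L.lattice) :
    AnalyticAt ℂ (L.orbitSum k u) z := by
  refine Finset.analyticAt_fun_sum _ fun ξ hξ => AnalyticAt.sub ?_ analyticAt_const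
  exact (L.analyticAt_sFun k (h ξ ((Polynomial.mem_nthRootsFinset (by omega) 1).mp hξ))).comp_of_eq
    (by fun_prop) rfl

theorem orbitSum_zero (k : ℕ) (u : ℂ) : L.orbitSum k u 0 = 0 := by
  simp [orbitSum]

theorem orbitSum_add (k : ℕ) (u z : ℂ) {v : ℂ} (hv : v ∈ L.lattice) :
    L.orbitSum k u (z + v) = L.orbitSum k u z := by
  simp only [orbitSum, add_sub_right_comm, L.sFun_add k hv]

/-- The fibres of `S_Λ` are the orbits of the roots of unity modulo `Λ`, and the `(k + 2)`-nd
derivative of `log (S_Λ u - S_Λ z)` with respect to `u` is the sum `orbitSum`.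

As functions of `z`, both sides are meromorphic and agree near `0`, hence everywhere. The derivative
is a rational function of `S_Λ z`, so it cannot tend to infinity as `z → u` and have a finite limit
at another point of the fibre of `S_Λ u`. -/
theorem sFun_ne_and_iteratedDerivLog_eq (hinv : IsRootInvariant (k + 2) L.lattice) {u z : ℂ}
    (hu : u ∉ L.lattice) (hz : z ∉ L.lattice)
    (h : ∀ ξ : ℂ, ξ ^ (k + 2) = 1 → z - ξ * u ∉ L.lattice) :
    L.sFun k u ≠ L.sFun k z ∧
      (-1) ^ (k + 3) * iteratedDerivLog (k + 2) (fun v => L.sFun k v - L.sFun k z) u =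
        L.orbitSum k u z := by
  classical
  set s := L.sFun k u with hs
  obtain ⟨N, a, -, ha⟩ := exists_iteratedDeriv_logDeriv_sub_eq (L.sFun k) (k + 1)
  set φ : ℂ → ℂ := fun w => (-1) ^ (k + 3) * ∑ i ∈ Finset.range N, a i u * (s - w)⁻¹ ^ (i + 1)
    with hφ
  have hφeq : ∀ w, s ≠ w → (-1) ^ (k + 3) * iteratedDerivLog (k + 2) (fun v => L.sFun k v - w) u =
      φ w := fun w hw => by
    simp only [hφ]
    rw [← ha u w (L.analyticAt_sFun k hu) hw]
    rfl
  set F : ℂ → ℂ := fun x => φ (L.sFun k x) - L.orbitSum k u x with hF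
  have hFm : MeromorphicOn F Set.univ := by
    intro x _
    have h1 := L.meromorphic_sFun k x
    obtain ⟨b, g, hg, -, hgx⟩ := L.exists_hasLaurent_orbitSum k u x
    have h2 : MeromorphicAt (L.orbitSum k u) x := by
      refine MeromorphicAt.congr (f := fun z => _ / (z - x) ^ (k + 2) + g z) ?_
        (hgx.mono fun z hz => hz.symm)
      have := hg.meromorphicAt
      fun_prop
    have h3 : MeromorphicAt (fun x => φ (L.sFun k x)) x := by
      simp only [hφ]
      fun_prop
    exact h3.fun_sub h2
  have hF0 : meromorphicOrderAt F 0 = ⊤ := by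
    rw [meromorphicOrderAt_eq_top_iff]
    filter_upwards [L.eventually_iteratedDerivLog_eq_orbitSum hinv, L.eventually_sFun_ne k s 0]
      with x hx hxs
    rw [hF, sub_eq_zero, ← hφeq _ hxs.symm, hx u hu hxs.symm]
  have hall : ∀ x, ∀ᶠ y in 𝓝[≠] x, L.orbitSum k u y = φ (L.sFun k y) := by
    intro x
    have h1 : meromorphicOrderAt F x = ⊤ := by
      by_contra hne
      exact hFm.meromorphicOrderAt_ne_top_of_isPreconnected isPreconnected_univ (Set.mem_univ x)
        (Set.mem_univ 0) hne hF0
    filter_upwards [meromorphicOrderAt_eq_top_iff.mp h1] with y hy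
    exact (sub_eq_zero.mp hy).symm
  have hlimz : Tendsto (L.orbitSum k u) (𝓝[≠] z) (𝓝 (L.orbitSum k u z)) :=
    (L.analyticAt_orbitSum h).continuousAt.tendsto.mono_left nhdsWithin_le_nhds
  have hlimu : Tendsto (L.orbitSum k u) (𝓝[≠] u) (Bornology.cobounded ℂ) := by
    obtain ⟨b, hb⟩ := L.exists_hasLaurent_orbitSum k u u
    refine hb.tendsto_cobounded (mul_ne_zero ?_ (sCoeff_ne_zero k)) (by omega)
    rw [Nat.cast_ne_zero, Finset.card_ne_zero]
    refine ⟨1, Finset.mem_filter.mpr ⟨?_, by simp⟩⟩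
    exact (Polynomial.mem_nthRootsFinset (by omega) 1).mpr (one_pow _)
  have htend : ∀ x, x ∉ L.lattice → L.sFun k x = s →
      Tendsto (L.sFun k) (𝓝[≠] x) (𝓝[≠] s) := by
    intro x hx hxs
    refine tendsto_nhdsWithin_iff.mpr ⟨?_, L.eventually_sFun_ne k s x⟩
    rw [← hxs]
    exact (L.analyticAt_sFun k hx).continuousAt.tendsto.mono_left nhdsWithin_le_nhds
  -- `φ` tends either to infinity or to a finite limit at `s`, along `z` and along `u` alike.
  have hne : s ≠ L.sFun k z := by
    intro hsz
    have hdisj : ∀ c : ℂ, Disjoint (𝓝 c) (Bornology.cobounded ℂ) := fun c =>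
      Metric.disjoint_nhds_cobounded c
    have hφm : MeromorphicAt φ s := by
      simp only [hφ]
      fun_prop
    rcases lt_or_ge (meromorphicOrderAt φ s) 0 with hlt | hge
    · have h1 := (tendsto_cobounded_of_meromorphicOrderAt_neg hlt).comp (htend z hz hsz.symm)
      exact (hlimz.congr' (hall z)).not_tendsto (hdisj _) h1
    · obtain ⟨c, hc⟩ := tendsto_nhds_of_meromorphicOrderAt_nonneg hφm hge
      exact (hc.comp (htend u hu rfl)).not_tendsto (hdisj c) (hlimu.congr' (hall u))
  refine ⟨hne, ?_⟩
  rw [hφeq _ hne]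
  have hcont : ContinuousAt (fun x => φ (L.sFun k x)) z := by
    have h1 := (L.analyticAt_sFun k hz).continuousAt
    have h2 : s - L.sFun k z ≠ 0 := sub_ne_zero.mpr hne
    simp only [hφ]
    fun_prop (disch := assumption)
  exact tendsto_nhds_unique ((hcont.tendsto.mono_left nhdsWithin_le_nhds).congr'
    ((hall z).mono fun y hy => hy.symm)) hlimz

end PeriodPair

/-! ### Summation over the orbits -/

theorem finite_setOf_pow_eq_one {n : ℕ} (hn : 0 < n) : {ξ : ℂ | ξ ^ n = 1}.Finite :=
  (Polynomial.nthRootsFinset n (1 : ℂ)).finite_toSet.subset fun _ hξ =>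
    (Polynomial.mem_nthRootsFinset hn 1).mpr hξ

theorem stabilizerCard_ne_zero {n : ℕ} (hn : 0 < n) (Λ : Submodule ℤ ℂ) (u : ℂ) :
    stabilizerCard n Λ u ≠ 0 :=
  Set.ncard_ne_zero_of_mem (a := 1) ⟨one_pow n, by simp⟩
    ((finite_setOf_pow_eq_one hn).subset fun _ h => h.1)

/-- The roots of unity carrying the class of `u` to that of `v` form a coset of the stabilizer. -/
theorem card_filter_sub_mul_mem_eq_stabilizerCard {n : ℕ} (hn : 0 < n) {Λ : Submodule ℤ ℂ}
    [DecidablePred (· ∈ Λ)] (hinv : IsRootInvariant n Λ) {u v η : ℂ} (hη : η ^ n = 1)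
    (h : v - η * u ∈ Λ) :
    ((Polynomial.nthRootsFinset n (1 : ℂ)).filter fun ξ => v - ξ * u ∈ Λ).card =
      stabilizerCard n Λ u := by
  have hη0 : η ≠ 0 := by
    rintro rfl
    rw [zero_pow hn.ne'] at hη
    exact zero_ne_one hη
  have hη' : η⁻¹ ^ n = 1 := by rw [inv_pow, hη, inv_one]
  rw [stabilizerCard, ← Set.ncard_image_of_injective _ (mul_right_injective₀ hη0),
    ← Set.ncard_coe_finset]
  congr 1
  ext ξ
  simp only [Finset.coe_filter, Polynomial.mem_nthRootsFinset hn, Set.mem_ofPred_eq, Set.mem_image]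
  constructor
  · rintro ⟨h1, h2⟩
    refine ⟨η⁻¹ * ξ, ⟨by rw [mul_pow, hη', h1, one_mul], ?_⟩, mul_inv_cancel_left₀ hη0 ξ⟩
    have := hinv _ hη' _ (Λ.sub_mem h h2)
    convert this using 1
    field_simp
    ring
  · rintro ⟨ζ, ⟨h1, h2⟩, rfl⟩
    refine ⟨by rw [mul_pow, hη, h1, one_mul], ?_⟩
    have := Λ.sub_mem h (hinv _ hη _ h2)
    convert this using 1
    ring

/-- If the order of a class is coprime to the order of the group of roots of unity, then no
non-trivial root of unity fixes the class. -/
theorem stabilizerCard_eq_one {n p : ℕ} {Λ : Submodule ℤ ℂ} (hinv : IsRootInvariant n Λ)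
    (hp : p.Coprime n) {u : ℂ} (hu : u ∉ Λ) (hpu : (p : ℂ) * u ∈ Λ) :
    stabilizerCard n Λ u = 1 := by
  rw [stabilizerCard, Set.ncard_eq_one]
  refine ⟨1, Set.eq_singleton_iff_unique_mem.mpr ⟨⟨one_pow n, by simp⟩, ?_⟩⟩
  rintro ξ ⟨hξ, h⟩
  by_contra hne
  -- `1 + ξ + ⋯ + ξ ^ (n - 1) = 0`, while each `ξ ^ i` fixes the class of `u`.
  have hpow : ∀ i : ℕ, ξ ^ i * u - u ∈ Λ := by
    intro i
    induction i with
    | zero => simp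
    | succ i ih =>
      have := Λ.add_mem (hinv _ hξ _ ih) h
      convert this using 1
      ring
  have hsum : ∑ i ∈ Finset.range n, (ξ ^ i * u - u) = -((n : ℂ) * u) := by
    have hgeom : ∑ i ∈ Finset.range n, ξ ^ i = 0 := by
      rw [geom_sum_eq hne, hξ, sub_self, zero_div]
    rw [Finset.sum_sub_distrib, ← Finset.sum_mul, hgeom]
    simp
  have hnu : (n : ℂ) * u ∈ Λ := by
    have := Λ.neg_mem (hsum ▸ Λ.sum_mem fun i _ => hpow i)
    rwa [neg_neg] at this
  apply hu
  have hb : (p : ℤ) * p.gcdA n + n * p.gcdB n = 1 := by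
    rw [← Nat.gcd_eq_gcd_ab, hp.gcd_eq_one, Nat.cast_one]
  have hb' : (p : ℂ) * (p.gcdA n : ℂ) + n * (p.gcdB n : ℂ) = 1 := by exact_mod_cast hb
  have := Λ.add_mem (Λ.smul_mem (p.gcdA n) hpu) (Λ.smul_mem (p.gcdB n) hnu)
  convert this using 1
  rw [zsmul_eq_mul, zsmul_eq_mul]
  linear_combination -u * hb'

namespace PeriodPair

variable {L L' : PeriodPair} {k : ℕ} {U : Finset ℂ}

/-- `S_Λ'` is the sum of the translates of `S_Λ` by `Λ' / Λ`, up to a constant: both sides are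
`Λ`-periodic with the same polar terms. The sum is grouped into orbits; the roots of unity run
through each orbit as often as the order of the stabilizer. -/
theorem sFun_eq_sum_orbitSum (hle : L.lattice ≤ L'.lattice)
    (hinv : IsRootInvariant (k + 2) L.lattice) (hinv' : IsRootInvariant (k + 2) L'.lattice)
    (hU : IsOrbitTransversal (k + 2) L.lattice L'.lattice U) {z : ℂ} (hz : z ∉ L'.lattice) :
    L'.sFun k z = ∑ u ∈ U, (1 / (stabilizerCard (k + 2) L.lattice u : ℂ)) * L.orbitSum k u z +
      L.sFun k z + laurentConst (L'.sFun k) - laurentConst (L.sFun k) := by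
  classical
  have hroot : ∀ ξ : ℂ, ξ ∈ Polynomial.nthRootsFinset (k + 2) (1 : ℂ) → ξ ^ (k + 2) = 1 :=
    fun ξ h => (Polynomial.mem_nthRootsFinset (by omega) 1).mp h
  set T : ℂ → ℂ := fun z =>
    ∑ u ∈ U, (1 / (stabilizerCard (k + 2) L.lattice u : ℂ)) * L.orbitSum k u z with hT
  set κ : ℂ := laurentConst (L'.sFun k) - laurentConst (L.sFun k) with hκ
  set D : ℂ → ℂ := fun x => L'.sFun k x - L.sFun k x - T x - κ with hD
  suffices D z = 0 by
    simp only [hD, hT, hκ] at this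
    linear_combination this
  have hroot_notMem : ∀ ξ : ℂ, ξ ^ (k + 2) = 1 → ∀ u ∉ L.lattice, ξ * u ∉ L.lattice := by
    intro ξ hξ u hu h
    have h0 : ξ ≠ 0 := by
      rintro rfl
      simp at hξ
    have := hinv ξ⁻¹ (by rw [inv_pow, hξ, inv_one]) _ h
    rw [inv_mul_cancel_left₀ h0] at this
    exact hu this
  have hnotU : ∀ x, (x ∈ L.lattice ∨ x ∉ L'.lattice) → ∀ u ∈ U, ∀ ξ : ℂ, ξ ^ (k + 2) = 1 →
      x - ξ * u ∉ L.lattice := by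
    rintro x (hx | hx) u hu ξ hξ h
    · refine hroot_notMem ξ hξ u (hU.1 u hu).2 ?_
      have := L.lattice.sub_mem hx h
      rwa [sub_sub_cancel] at this
    · refine hx ?_
      have := L'.lattice.add_mem (hle h) (hinv' ξ hξ u (hU.1 u hu).1)
      rwa [sub_add_cancel] at this
  have hTan : ∀ x, (x ∈ L.lattice ∨ x ∉ L'.lattice) → AnalyticAt ℂ T x := fun x hx =>
    Finset.analyticAt_fun_sum _ fun u hu =>
      analyticAt_const.mul (L.analyticAt_orbitSum (hnotU x hx u hu))
  have hper : ∀ x, ∀ v ∈ L.lattice, D (x + v) = D x := fun x v hv => by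
    simp only [hD, hT, L.sFun_add k hv, L'.sFun_add k (hle hv), L.orbitSum_add k _ _ hv]
  have hlat : ∀ x ∈ L.lattice, HasLaurent D (k + 2) 0 (-T x) x := by
    intro x hx
    have := (((L'.hasLaurent_sFun k (hle hx)).sub (L.hasLaurent_sFun k hx)).sub
      (HasLaurent.of_analyticAt (hTan x (Or.inl hx)) _)).sub_const κ
    convert this using 1
    · ring
    · rw [hκ]
      ring
  have hout : ∀ x ∉ L'.lattice, AnalyticAt ℂ D x := fun x hx =>
    (((L'.analyticAt_sFun k hx).sub (L.analyticAt_sFun k fun h => hx (hle h))).sub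
      (hTan x (Or.inr hx))).sub analyticAt_const
  have h0 : HasLaurent D (k + 2) 0 0 0 := by
    convert hlat 0 L.lattice.zero_mem using 1
    simp [hT, L.orbitSum_zero]
  refine eq_zero_of_periodic_of_hasLaurent L.lattice hper (fun x => ?_) h0 (hout z hz)
  by_cases hx : x ∈ L.lattice
  · exact ⟨_, hlat x hx⟩
  by_cases hx' : x ∈ L'.lattice
  swap
  · exact ⟨_, HasLaurent.of_analyticAt (hout x hx') _⟩
  -- A point of `Λ'` outside `Λ` is a pole of the summand of exactly one orbit.
  obtain ⟨u, ⟨hu, η, hη, hηx⟩, huniq⟩ := hU.2 x hx' hx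
  choose b hb using fun v : ℂ => L.exists_hasLaurent_orbitSum k v x
  have hsum : ∑ v ∈ U, (1 / (stabilizerCard (k + 2) L.lattice v : ℂ)) *
      (((Polynomial.nthRootsFinset (k + 2) (1 : ℂ)).filter fun ξ => x - ξ * v ∈ L.lattice).card *
        sCoeff k) = sCoeff k := by
    rw [Finset.sum_eq_single_of_mem u hu]
    · rw [card_filter_sub_mul_mem_eq_stabilizerCard (by omega) hinv hη hηx]
      have : (stabilizerCard (k + 2) L.lattice u : ℂ) ≠ 0 :=
        Nat.cast_ne_zero.mpr (stabilizerCard_ne_zero (by omega) _ _)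
      field_simp
    · intro v hv hvu
      rw [Finset.card_eq_zero.mpr, Nat.cast_zero, zero_mul, mul_zero]
      rw [Finset.filter_eq_empty_iff]
      exact fun ξ hξ h => hvu (huniq v ⟨hv, ξ, hroot ξ hξ, h⟩)
  have h1 := (((L'.hasLaurent_sFun k hx').sub
    (HasLaurent.of_analyticAt (L.analyticAt_sFun k hx) _)).sub
      (HasLaurent.sum (s := U) fun v _ => (hb v).const_mul
        (1 / (stabilizerCard (k + 2) L.lattice v : ℂ)))).sub_const κ
  rw [hsum, sub_zero, sub_self] at h1
  exact ⟨_, h1⟩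

/-- The formula for `S_Λ'` in terms of `S_Λ`. -/
theorem sFun_ne_and_sFun_eq_sum (hle : L.lattice ≤ L'.lattice)
    (hinv : IsRootInvariant (k + 2) L.lattice) (hinv' : IsRootInvariant (k + 2) L'.lattice)
    (hU : IsOrbitTransversal (k + 2) L.lattice L'.lattice U) {z : ℂ} (hz : z ∉ L'.lattice) :
    (∀ u ∈ U, L.sFun k u ≠ L.sFun k z) ∧
      L'.sFun k z = (-1) ^ (k + 2 + 1) *
        ∑ u ∈ U, (1 / (stabilizerCard (k + 2) L.lattice u : ℂ)) *
          iteratedDerivLog (k + 2) (fun v => L.sFun k v - L.sFun k z) u +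
        L.sFun k z + laurentConst (L'.sFun k) - laurentConst (L.sFun k) := by
  have key := fun u (hu : u ∈ U) => L.sFun_ne_and_iteratedDerivLog_eq hinv (hU.1 u hu).2
    (fun h => hz (hle h)) fun ξ hξ h => hz (by
      have := L'.lattice.add_mem (hle h) (hinv' ξ hξ u (hU.1 u hu).1)
      rwa [sub_add_cancel] at this)
  refine ⟨fun u hu => (key u hu).1, ?_⟩
  rw [sFun_eq_sum_orbitSum hle hinv hinv' hU hz, Finset.mul_sum]
  congr 3
  refine Finset.sum_congr rfl fun u hu => ?_
  rw [← (key u hu).2]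
  ring

end PeriodPair

/-! ### Rational functions and their values -/

namespace RatFunc

/-- `R` has no pole at `w`, and takes the value `x` there. -/
def HasValue (R : RatFunc ℂ) (w x : ℂ) : Prop :=
  R.denom.eval w ≠ 0 ∧ R.eval (RingHom.id ℂ) w = x

namespace HasValue

variable {R Q : RatFunc ℂ} {w x y : ℂ}

theorem add (h : R.HasValue w x) (h' : Q.HasValue w y) : (R + Q).HasValue w (x + y) := by
  refine ⟨fun h0 => ?_, ?_⟩
  · have := Polynomial.eval_eq_zero_of_dvd_of_eval_eq_zero (denom_add_dvd R Q) h0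
    rw [Polynomial.eval_mul] at this
    exact (mul_ne_zero h.1 h'.1) this
  · rw [eval_add _ _ h.1 h'.1, h.2, h'.2]

theorem mul (h : R.HasValue w x) (h' : Q.HasValue w y) : (R * Q).HasValue w (x * y) := by
  refine ⟨fun h0 => ?_, ?_⟩
  · have := Polynomial.eval_eq_zero_of_dvd_of_eval_eq_zero (denom_mul_dvd R Q) h0
    rw [Polynomial.eval_mul] at this
    exact (mul_ne_zero h.1 h'.1) this
  · rw [eval_mul _ _ h.1 h'.1, h.2, h'.2]

theorem C (c w : ℂ) : (RatFunc.C c).HasValue w c :=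
  ⟨by simp, by simp⟩

theorem X (w : ℂ) : (RatFunc.X : RatFunc ℂ).HasValue w w :=
  ⟨by simp, by simp⟩

theorem pow (h : R.HasValue w x) (n : ℕ) : (R ^ n).HasValue w (x ^ n) := by
  induction n with
  | zero => simpa using C 1 w
  | succ n ih =>
    rw [pow_succ, pow_succ]
    exact ih.mul h

theorem sum {ι : Type*} {s : Finset ι} {F : ι → RatFunc ℂ} {f : ι → ℂ}
    (h : ∀ i ∈ s, (F i).HasValue w (f i)) : (∑ i ∈ s, F i).HasValue w (∑ i ∈ s, f i) := by
  classical
  induction s using Finset.induction_on with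
  | empty => simpa using C 0 w
  | insert i s hi ih =>
    rw [Finset.sum_insert hi, Finset.sum_insert hi]
    exact (h i (Finset.mem_insert_self _ _)).add
      (ih fun j hj => h j (Finset.mem_insert_of_mem hj))

theorem inv (h : R.HasValue w x) (hx : x ≠ 0) : R⁻¹.HasValue w x⁻¹ := by
  have hR : R ≠ 0 := by
    rintro rfl
    have := h.2
    simp only [eval_zero] at this
    exact hx this.symm
  have hnum : R.num.eval w ≠ 0 := fun h0 => by
    have := h.2
    rw [eval, Polynomial.eval₂_id, h0, zero_div] at this
    exact hx this.symm
  have hden : R⁻¹.denom.eval w ≠ 0 := fun h0 =>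
    hnum (Polynomial.eval_eq_zero_of_dvd_of_eval_eq_zero (denom_inv_dvd hR) h0)
  refine ⟨hden, ?_⟩
  have := eval_mul (f := RingHom.id ℂ) (a := w) (x := R) (y := R⁻¹) h.1 hden
  rw [mul_inv_cancel₀ hR, eval_one, h.2] at this
  exact eq_inv_of_mul_eq_one_right this.symm

end HasValue

/-- Rational functions which agree at infinitely many points are equal. -/
theorem eq_of_infinite_hasValue {R Q : RatFunc ℂ}
    (h : {w | ∃ x, R.HasValue w x ∧ Q.HasValue w x}.Infinite) : R = Q := by
  have hpoly : R.num * Q.denom - Q.num * R.denom = 0 := by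
    refine Polynomial.eq_zero_of_infinite_isRoot _ (h.mono ?_)
    rintro w ⟨x, hR, hQ⟩
    have h1 := hR.2
    have h2 := hQ.2
    rw [eval, Polynomial.eval₂_id, Polynomial.eval₂_id, div_eq_iff hR.1] at h1
    rw [eval, Polynomial.eval₂_id, Polynomial.eval₂_id, div_eq_iff hQ.1] at h2
    simp only [Set.mem_ofPred_eq, Polynomial.IsRoot, Polynomial.eval_sub, Polynomial.eval_mul, h1,
      h2]
    ring
  rw [← num_div_denom R, ← num_div_denom Q, div_eq_div_iff
    (algebraMap_ne_zero R.denom_ne_zero) (algebraMap_ne_zero Q.denom_ne_zero), ← map_mul,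
    ← map_mul, sub_eq_zero.mp hpoly]

end RatFunc

/-! ### The rational function -/

namespace PeriodPair

variable {L L' : PeriodPair} {k : ℕ}

/-- The right-hand side of the formula for `S_Λ'` is a rational function of `w`. -/
theorem exists_ratFunc_hasValue (L : PeriodPair) (k : ℕ) {U : Finset ℂ}
    (hU : ∀ u ∈ U, u ∉ L.lattice) (r : ℂ → ℂ) (e b d : ℂ) :
    ∃ R : RatFunc ℂ, ∀ w : ℂ, (∀ u ∈ U, L.sFun k u ≠ w) →
      R.HasValue w (e * ∑ u ∈ U, r u *
        iteratedDerivLog (k + 2) (fun v => L.sFun k v - w) u + w + b - d) := by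
  obtain ⟨N, a, -, ha⟩ := exists_iteratedDeriv_logDeriv_sub_eq (L.sFun k) (k + 1)
  refine ⟨RatFunc.C e * ∑ u ∈ U, RatFunc.C (r u) * ∑ i ∈ Finset.range N, RatFunc.C (a i u) *
    (RatFunc.C (L.sFun k u) + RatFunc.C (-1) * RatFunc.X)⁻¹ ^ (i + 1) + RatFunc.X + RatFunc.C b +
      RatFunc.C (-d), fun w hw => ?_⟩
  rw [sub_eq_add_neg _ d]
  refine ((((RatFunc.HasValue.C e w).mul (RatFunc.HasValue.sum fun u hu =>
    (RatFunc.HasValue.C _ w).mul ?_)).add (RatFunc.HasValue.X w)).add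
      (RatFunc.HasValue.C b w)).add (RatFunc.HasValue.C (-d) w)
  have h1 : iteratedDerivLog (k + 2) (fun v => L.sFun k v - w) u =
      ∑ i ∈ Finset.range N, a i u * (L.sFun k u + -1 * w)⁻¹ ^ (i + 1) := by
    rw [neg_one_mul, ← sub_eq_add_neg, ← ha u w (L.analyticAt_sFun k (hU u hu)) (hw u hu)]
    rfl
  rw [h1]
  refine RatFunc.HasValue.sum fun i _ => (RatFunc.HasValue.C _ w).mul
    (RatFunc.HasValue.pow (RatFunc.HasValue.inv ((RatFunc.HasValue.C _ w).add
      ((RatFunc.HasValue.C _ w).mul (RatFunc.HasValue.X w))) ?_) _)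
  rw [neg_one_mul, ← sub_eq_add_neg]
  exact sub_ne_zero.mpr (hw u hu)

theorem infinite_sFun_image (L L' : PeriodPair) (k : ℕ) :
    (L.sFun k '' {z | z ∉ L'.lattice}).Infinite := by
  intro hfin
  have h1 := (L.tendsto_sFun_cobounded k L.lattice.zero_mem).eventually
    (Bornology.isBounded_def.mp hfin.isBounded)
  obtain ⟨z, hz, hz'⟩ := (h1.and (L'.eventually_punctured_notMem_lattice 0)).exists
  exact hz ⟨z, hz', rfl⟩

theorem exists_ratFunc_sFun_eq {p : ℕ} (hp : 0 < p) (hle : L.lattice ≤ L'.lattice)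
    (hidx : L.lattice.toAddSubgroup.relIndex L'.lattice.toAddSubgroup = p)
    (hinv : IsRootInvariant (k + 2) L.lattice) (hinv' : IsRootInvariant (k + 2) L'.lattice) :
    ∃ R : RatFunc ℂ, ∀ U : Finset ℂ, IsOrbitTransversal (k + 2) L.lattice L'.lattice U →
      (∀ w : ℂ, (∀ u ∈ U, L.sFun k u ≠ w) →
        R.denom.eval w ≠ 0 ∧
        R.eval (RingHom.id ℂ) w =
          (-1) ^ (k + 2 + 1) *
              ∑ u ∈ U, (1 / (stabilizerCard (k + 2) L.lattice u : ℂ)) *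
                iteratedDerivLog (k + 2) (fun v => L.sFun k v - w) u
            + w + laurentConst (L'.sFun k) - laurentConst (L.sFun k) ∧
        (p.Coprime (k + 2) →
          R.eval (RingHom.id ℂ) w =
            (-1) ^ (k + 2 + 1) *
                ∑ u ∈ U, iteratedDerivLog (k + 2) (fun v => L.sFun k v - w) u
              + w + laurentConst (L'.sFun k) - laurentConst (L.sFun k))) ∧
      ∀ z : ℂ, z ∉ L'.lattice →
        (∀ u ∈ U, L.sFun k u ≠ L.sFun k z) ∧
        L'.sFun k z = R.eval (RingHom.id ℂ) (L.sFun k z) := by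
  have hex := fun (U : Finset ℂ) (hU : IsOrbitTransversal (k + 2) L.lattice L'.lattice U) =>
    exists_ratFunc_hasValue L k (fun u hu => (hU.1 u hu).2)
      (fun u => 1 / (stabilizerCard (k + 2) L.lattice u : ℂ)) ((-1) ^ (k + 2 + 1))
      (laurentConst (L'.sFun k)) (laurentConst (L.sFun k))
  obtain ⟨U₀, hU₀⟩ := exists_isOrbitTransversal (n := k + 2) (by omega) hinv
    (Λ' := L'.lattice) (by omega)
  obtain ⟨R, hR⟩ := hex U₀ hU₀
  refine ⟨R, fun U hU => ?_⟩
  -- The rational functions for any two choices of representatives coincide.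
  have hRU : ∀ w : ℂ, (∀ u ∈ U, L.sFun k u ≠ w) → R.HasValue w ((-1) ^ (k + 2 + 1) *
      ∑ u ∈ U, (1 / (stabilizerCard (k + 2) L.lattice u : ℂ)) *
        iteratedDerivLog (k + 2) (fun v => L.sFun k v - w) u
      + w + laurentConst (L'.sFun k) - laurentConst (L.sFun k)) := by
    obtain ⟨Q, hQ⟩ := hex U hU
    have : R = Q := by
      refine RatFunc.eq_of_infinite_hasValue ((infinite_sFun_image L L' k).mono ?_)
      rintro _ ⟨z, hz, rfl⟩
      have h₀ := sFun_ne_and_sFun_eq_sum hle hinv hinv' hU₀ hz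
      have h := sFun_ne_and_sFun_eq_sum hle hinv hinv' hU hz
      refine ⟨L'.sFun k z, ?_, ?_⟩
      · rw [h₀.2]
        exact hR _ h₀.1
      · rw [h.2]
        exact hQ _ h.1
    rw [this]
    exact hQ
  refine ⟨fun w hw => ⟨(hRU w hw).1, (hRU w hw).2, fun hcop => ?_⟩, fun z hz => ?_⟩
  · rw [(hRU w hw).2]
    congr 4
    refine Finset.sum_congr rfl fun u hu => ?_
    have hpu : (p : ℂ) * u ∈ L.lattice := by
      have := L.lattice.toAddSubgroup.nsmul_relIndex_mem
        (show u ∈ L'.lattice.toAddSubgroup from (hU.1 u hu).1)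
      rw [hidx, nsmul_eq_mul] at this
      exact this
    rw [stabilizerCard_eq_one hinv hcop (hU.1 u hu).2 hpu]
    simp
  · have h := sFun_ne_and_sFun_eq_sum hle hinv hinv' hU hz
    exact ⟨h.1, by rw [h.2, (hRU _ h.1).2]⟩

end PeriodPair

/-! ### The four cases, and the Weierstrass function with `p` odd -/

/-- All four cases are instances of the function `sFun`. -/
theorem TorusCase.exists_sFun (c : TorusCase) :
    ∃ k : ℕ, c.order = k + 2 ∧ ∀ L : PeriodPair, c.S L = L.sFun k := by
  cases c
  · exact ⟨0, rfl, fun L => by simp [TorusCase.S, PeriodPair.sFun]⟩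
  · exact ⟨1, rfl, fun L => rfl⟩
  · exact ⟨2, rfl, fun L => rfl⟩
  · exact ⟨4, rfl, fun L => rfl⟩

theorem isRootInvariant_two (Λ : Submodule ℤ ℂ) : IsRootInvariant 2 Λ := by
  intro ξ hξ v hv
  rcases sq_eq_one_iff.mp hξ with rfl | rfl
  · simpa using hv
  · simpa using hv

/-- The second derivative of `log (f - w)`. -/
theorem iteratedDerivLog_two_sub {f : ℂ → ℂ} {u w : ℂ} (hf : AnalyticAt ℂ f u) (hw : f u ≠ w) :
    iteratedDerivLog 2 (fun v => f v - w) u =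
      iteratedDeriv 2 f u / (f u - w) - (iteratedDeriv 1 f u / (f u - w)) ^ 2 := by
  have h0 : f u - w ≠ 0 := sub_ne_zero.mpr hw
  have h1 : logDeriv (fun v => f v - w) = fun v => deriv f v / (f v - w) := by
    ext v
    rw [logDeriv_apply, deriv_sub_const]
  have h2 := (hf.deriv.differentiableAt.hasDerivAt.fun_div
    (hf.differentiableAt.hasDerivAt.sub_const w) h0).deriv
  rw [iteratedDerivLog, show 2 - 1 = 1 from rfl, iteratedDeriv_one, h1, h2, iteratedDeriv_one,
    iteratedDeriv_succ, iteratedDeriv_one]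
  field_simp

namespace PeriodPair

variable {L L' : PeriodPair} {τ : ℂ} {p : ℕ}

theorem intCast_add_mem_lattice_iff (h₁ : L'.ω₁ = 1) (h₂ : L'.ω₂ = τ) (h₃ : L.ω₁ = p)
    (h₄ : L.ω₂ = τ) (m n : ℤ) : (m : ℂ) + n * τ ∈ L.lattice ↔ (p : ℤ) ∣ m := by
  rw [mem_lattice, h₃, h₄]
  constructor
  · rintro ⟨a, b, h⟩
    have := LinearIndependent.pair_iff.mp L'.indep (a * p - m : ℝ) (b - n : ℝ) (by
      rw [h₁, h₂]
      simp only [Complex.real_smul]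
      push_cast
      linear_combination h)
    refine ⟨a, ?_⟩
    have h5 : (a * p : ℝ) = m := sub_eq_zero.mp this.1
    have h6 : a * (p : ℤ) = m := by exact_mod_cast h5
    rw [← h6, mul_comm]
  · rintro ⟨a, rfl⟩
    refine ⟨a, n, ?_⟩
    push_cast
    ring

theorem isOrbitTransversal_Icc (hp : Odd p) (h₁ : L'.ω₁ = 1) (h₂ : L'.ω₂ = τ) (h₃ : L.ω₁ = p)
    (h₄ : L.ω₂ = τ) : IsOrbitTransversal 2 L.lattice L'.lattice
      ((Finset.Icc 1 ((p - 1) / 2)).image fun u : ℕ => (u : ℂ)) := by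
  have hmem := intCast_add_mem_lattice_iff h₁ h₂ h₃ h₄
  obtain ⟨q, rfl⟩ := hp
  rw [show (2 * q + 1 - 1) / 2 = q by omega]
  refine ⟨fun x hx => ?_, fun v hv hv' => ?_⟩
  · obtain ⟨u, hu, rfl⟩ := Finset.mem_image.mp hx
    rw [Finset.mem_Icc] at hu
    refine ⟨mem_lattice.mpr ⟨u, 0, by simp [h₁]⟩, fun h => ?_⟩
    have := (hmem u 0).mp (by simpa using h)
    have := Int.le_of_dvd (by omega) this
    push_cast at this
    omega
  · obtain ⟨m, n, rfl⟩ := mem_lattice.mp hv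
    rw [h₁, h₂, mul_one] at hv' ⊢
    rw [hmem] at hv'
    have hcong : ∀ (ε : ℤ) (u : ℕ), (m : ℂ) + n * τ - ε * u ∈ L.lattice ↔
        ((2 * q + 1 : ℕ) : ℤ) ∣ m - ε * u := by
      intro ε u
      rw [← hmem _ n]
      push_cast
      rw [add_sub_right_comm]
    have hexists : ∃ (u : ℕ) (ε : ℤ), u ∈ Finset.Icc 1 q ∧ (ε = 1 ∨ ε = -1) ∧
        ((2 * q + 1 : ℕ) : ℤ) ∣ m - ε * u := by
      have e1 := Int.emod_add_mul_ediv m ((2 * q + 1 : ℕ) : ℤ)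
      have e2 := Int.emod_nonneg m (b := ((2 * q + 1 : ℕ) : ℤ)) (by omega)
      have e3 := Int.emod_lt_of_pos m (b := ((2 * q + 1 : ℕ) : ℤ)) (by omega)
      have e4 : m % ((2 * q + 1 : ℕ) : ℤ) ≠ 0 := fun h => hv' (Int.dvd_of_emod_eq_zero h)
      set r := m % ((2 * q + 1 : ℕ) : ℤ)
      set t := m / ((2 * q + 1 : ℕ) : ℤ)
      by_cases hr : r ≤ q
      · refine ⟨r.toNat, 1, Finset.mem_Icc.mpr ⟨by omega, by omega⟩, Or.inl rfl, t, ?_⟩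
        rw [Int.toNat_of_nonneg e2]
        linear_combination -e1
      · refine ⟨(2 * q + 1 - r).toNat, -1, Finset.mem_Icc.mpr ⟨by omega, by omega⟩, Or.inr rfl,
          t + 1, ?_⟩
        push_cast at e3
        rw [Int.toNat_of_nonneg (by omega)]
        push_cast at e1 ⊢
        linear_combination -e1
    obtain ⟨u, ε, hu, hε, hdvd⟩ := hexists
    refine ⟨u, ⟨Finset.mem_image_of_mem _ hu, (ε : ℂ), ?_, (hcong ε u).mpr hdvd⟩, ?_⟩
    · rcases hε with rfl | rfl <;> simp
    · rintro _ ⟨hx, ξ, hξ, h⟩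
      obtain ⟨u', hu', rfl⟩ := Finset.mem_image.mp hx
      obtain ⟨ε', hε', rfl⟩ : ∃ ε' : ℤ, (ε' = 1 ∨ ε' = -1) ∧ ξ = ε' := by
        rcases sq_eq_one_iff.mp hξ with rfl | rfl
        · exact ⟨1, Or.inl rfl, by simp⟩
        · exact ⟨-1, Or.inr rfl, by simp⟩
      have h5 := dvd_sub ((hcong ε' u').mp h) hdvd
      rw [Finset.mem_Icc] at hu hu'
      have h6 := Int.eq_zero_of_abs_lt_dvd h5 (by
        rw [abs_lt]
        rcases hε with rfl | rfl <;> rcases hε' with rfl | rfl <;> constructor <;> push_cast <;>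
          omega)
      have : u' = u := by
        rcases hε with rfl | rfl <;> rcases hε' with rfl | rfl <;> omega
      rw [this]

theorem weierstrassP_ne_and_eq_sum (hp : Odd p) (h₁ : L'.ω₁ = 1) (h₂ : L'.ω₂ = τ) (h₃ : L.ω₁ = p)
    (h₄ : L.ω₂ = τ) {z : ℂ} (hz : z ∉ L'.lattice) :
    (∀ u ∈ Finset.Icc 1 ((p - 1) / 2), L.weierstrassP (u : ℂ) ≠ L.weierstrassP z) ∧
      L'.weierstrassP z =
        ∑ u ∈ Finset.Icc 1 ((p - 1) / 2),
          ((iteratedDeriv 1 L.weierstrassP (u : ℂ) /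
              (L.weierstrassP (u : ℂ) - L.weierstrassP z)) ^ 2 -
            iteratedDeriv 2 L.weierstrassP (u : ℂ) /
              (L.weierstrassP (u : ℂ) - L.weierstrassP z))
        + L.weierstrassP z := by
  have hmem := intCast_add_mem_lattice_iff h₁ h₂ h₃ h₄
  have hle : L.lattice ≤ L'.lattice := by
    intro x hx
    obtain ⟨a, b, rfl⟩ := mem_lattice.mp hx
    refine mem_lattice.mpr ⟨a * p, b, ?_⟩
    rw [h₁, h₂, h₃, h₄]
    push_cast
    ring
  have hU := isOrbitTransversal_Icc hp h₁ h₂ h₃ h₄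
  have hS : ∀ M : PeriodPair, M.sFun 0 = M.weierstrassP := fun M => by simp [sFun]
  have key := sFun_ne_and_sFun_eq_sum (k := 0) hle (isRootInvariant_two _) (isRootInvariant_two _)
    hU hz
  simp only [hS, laurentConst_weierstrassP, Finset.forall_mem_image, add_zero, sub_zero,
    zero_add] at key
  refine ⟨fun u hu => key.1 hu, ?_⟩
  rw [key.2, Finset.sum_image fun _ _ _ _ h => Nat.cast_injective h, Finset.mul_sum]
  congr 1
  refine Finset.sum_congr rfl fun u hu => ?_
  have hu' := (hU.1 u (Finset.mem_image_of_mem _ hu)).2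
  have hpu : (p : ℂ) * u ∈ L.lattice := by
    simpa using (hmem (p * u) 0).mpr (Dvd.intro _ rfl)
  rw [stabilizerCard_eq_one (isRootInvariant_two _) (Nat.coprime_two_right.mpr hp) hu' hpu,
    iteratedDerivLog_two_sub (L.analyticOnNhd_weierstrassP _ hu') (key.1 hu)]
  push_cast
  ring

end PeriodPair

theorem mainTheorem6 :
    (∀ (c : TorusCase) (L L' : PeriodPair) (p : ℕ), 0 < p →
      L.lattice ≤ L'.lattice →
      L.lattice.toAddSubgroup.relIndex L'.lattice.toAddSubgroup = p →
      IsRootInvariant c.order L.lattice →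
      IsRootInvariant c.order L'.lattice →
      ∃ R : RatFunc ℂ,
        ∀ U : Finset ℂ, IsOrbitTransversal c.order L.lattice L'.lattice U →
          (∀ w : ℂ, (∀ u ∈ U, c.S L u ≠ w) →
            R.denom.eval w ≠ 0 ∧
            R.eval (RingHom.id ℂ) w =
              (-1) ^ (c.order + 1) *
                  ∑ u ∈ U, (1 / (stabilizerCard c.order L.lattice u : ℂ)) *
                    iteratedDerivLog c.order (fun v => c.S L v - w) u
                + w + laurentConst (c.S L') - laurentConst (c.S L) ∧
            (p.Coprime c.order →
              R.eval (RingHom.id ℂ) w =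
                (-1) ^ (c.order + 1) *
                    ∑ u ∈ U, iteratedDerivLog c.order (fun v => c.S L v - w) u
                  + w + laurentConst (c.S L') - laurentConst (c.S L))) ∧
          ∀ z : ℂ, z ∉ L'.lattice →
            (∀ u ∈ U, c.S L u ≠ c.S L z) ∧
            c.S L' z = R.eval (RingHom.id ℂ) (c.S L z)) ∧
    (∀ (τ : ℂ) (p : ℕ) (L L' : PeriodPair), Odd p →
      L'.ω₁ = 1 → L'.ω₂ = τ → L.ω₁ = p → L.ω₂ = τ →
      ∀ z : ℂ, z ∉ L'.lattice →
        (∀ u ∈ Finset.Icc 1 ((p - 1) / 2), L.weierstrassP (u : ℂ) ≠ L.weierstrassP z) ∧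
        L'.weierstrassP z =
          ∑ u ∈ Finset.Icc 1 ((p - 1) / 2),
            ((iteratedDeriv 1 L.weierstrassP (u : ℂ) /
                (L.weierstrassP (u : ℂ) - L.weierstrassP z)) ^ 2 -
              iteratedDeriv 2 L.weierstrassP (u : ℂ) /
                (L.weierstrassP (u : ℂ) - L.weierstrassP z))
          + L.weierstrassP z) := by
  refine ⟨fun c L L' p hp hle hidx hinv hinv' => ?_, fun τ p L L' hp h₁ h₂ h₃ h₄ z hz =>
    PeriodPair.weierstrassP_ne_and_eq_sum hp h₁ h₂ h₃ h₄ hz⟩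
  obtain ⟨k, hk, hS⟩ := c.exists_sFun
  simp only [hk, hS] at hinv hinv' ⊢
  exact PeriodPair.exists_ratFunc_sFun_eq hp hle hidx hinv hinv'
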